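/- Consider $N$ agents $\dot x_i=Ax_i+Bu_i$, $y_i=Cx_i$ with $x_i\in\mathbb R^n$, $u_i\in\mathbb R^p$, $y_i\in\mathbb R^q$, where $(A,B)$ is stabilizable and $(A,C)$ is detectable, communicating over a connected undirected simple graph $\mathcal G$ with adjacency matrix $[a_{ij}]$, $a_{ij}\in\{0,1\}$. Let $F$ be any matrix such that $A+FC$ is Hurwitz, let $P>0$ solve $PA+A^TP-PBB^TP+I=0$, let $K=-B^TP$ and $\Gamma=PBB^TP$, and let $\kappa_{ij}=\kappa_{ji}$, $\varrho_{ij}=\varrho_{ji}$ (for the edges of $\mathcal G$), $\delta,\mu,\nu$ be any positive constants. Consider the observer-based adaptive event-triggered protocol $$\dot\chi_i=A\chi_i+Bu_i+F(C\chi_i-y_i),\qquad u_i=K\sum_{j=1}^N c_{ij}a_{ij}(\tilde\chi_i-\tilde\chi_j),$$ $$\dot c_{ij}=\kappa_{ij}a_{ij}\left[-\varrho_{ij}c_{ij}+(\tilde\chi_i-\tilde\chi_j)^T\Gamma(\tilde\chi_i-\tilde\chi_j)\right],\qquad c_{ij}(0)=c_{ji}(0)\ \text{for the edges},$$ where $\tilde\chi_i(t)=e^{A(t-t_k^i)}\chi_i(t_k^i)$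 for $t\in[t_k^i,t_{k+1}^i)$, $e_i=\tilde\chi_i-\chi_i$, $t_0^i=0$, and $t_{k+1}^i$ is the first time after $t_k^i$ at which $f_i\ge0$ (tested before the reset of $e_i$), with $$f_i(t)=\sum_{j=1}^N(1+\delta c_{ij})a_{ij}e_i^T\Gamma e_i-\tfrac14\sum_{j=1}^N a_{ij}(\tilde\chi_i-\tilde\chi_j)^T\Gamma(\tilde\chi_i-\tilde\chi_j)-\mu e^{-\nu t}.$$ If several agents trigger at the same instant, the test may use the neighbours' estimates from before or after their update. Executions are considered on intervals $[0,T)$, $0<T\le\infty$, such that events do not accumulate before $T$. Let $\zeta_i=x_i-\frac1N\sum_{j}x_j$ be the consensus error. Then $\zeta=[\zeta_1^T,\dots,\zeta_N^T]^T$, and $c_{ij}$ for every edge of $\mathcal G$, are uniformly ultimately bounded: there is $b>0$ such that for every $a>0$ there is $\tau\ge0$ such that, for every execution and every $t_0\in[0,T)$ at which the state of the error system, consisting of $\zeta$, $(\chi_i-x_i)_i$, $(e_i)_i$ and $(c_{ij})_{(i,j)\ \text{edge}}$, has size at most $a$, one has $\|\zeta(t)\|\le b$ and $|c_{ij}(t)|\le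 b$ for all $t\in[t_0+\tau,T)$. Moreover there is no Zeno behavior: in no execution does an agent have infinitely many events within a finite period of time (in particular, if $T<\infty$, each agent has finitely many events on $[0,T)$). -/

import Mathlib

open scoped Matrix

noncomputable section

namespace EventConsensus

/-- A real square matrix is Hurwitz: all its complex eigenvalues have negative real part. -/
def IsHurwitz {n : ℕ} (M : Matrix (Fin n) (Fin n) ℝ) : Prop :=
  ∀ z ∈ spectrum ℂ (M.map (algebraMap ℝ ℂ)), z.re < 0

/-- `(A, B)` is stabilizable. -/
def IsStabilizable {n p : ℕ} (A : Matrix (Fin n) (Fin n) ℝ) (B : Matrix (Fin n) (Fin p) ℝ) :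
    Prop :=
  ∃ L : Matrix (Fin p) (Fin n) ℝ, IsHurwitz (A + B * L)

/-- `(A, C)` is detectable. -/
def IsDetectable {n q : ℕ} (A : Matrix (Fin n) (Fin n) ℝ) (C : Matrix (Fin q) (Fin n) ℝ) :
    Prop :=
  ∃ L : Matrix (Fin n) (Fin q) ℝ, IsHurwitz (A + L * C)

/-- `vᵀ Γ v`. -/
def quad {n : ℕ} (Γ : Matrix (Fin n) (Fin n) ℝ) (v : Fin n → ℝ) : ℝ := v ⬝ᵥ (Γ *ᵥ v)

/-- Euclidean norm of the stacked vector `[v₁ᵀ, …, v_Nᵀ]ᵀ`. -/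
def stackNorm {N n : ℕ} (v : Fin N → Fin n → ℝ) : ℝ := Real.sqrt (∑ i, ∑ l, v i l ^ 2)

/-- All constants of the closed loop: agent matrices, communication graph, gain matrices, and
the constants of the coupling-gain adaptation and of the triggering function. -/
structure Loop (N n p q : ℕ) where
  A : Matrix (Fin n) (Fin n) ℝ
  B : Matrix (Fin n) (Fin p) ℝ
  C : Matrix (Fin q) (Fin n) ℝ
  G : SimpleGraph (Fin N)
  F : Matrix (Fin n) (Fin q) ℝ
  K : Matrix (Fin p) (Fin n) ℝ
  Γ : Matrix (Fin n) (Fin n) ℝ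
  κ : Fin N → Fin N → ℝ
  ϱ : Fin N → Fin N → ℝ
  δ : ℝ
  μ : ℝ
  ν : ℝ

namespace Loop

variable {N n p q : ℕ} (S : Loop N n p q)

open Classical in
/-- Adjacency weight `a_ij ∈ {0, 1}`. -/
def a (i j : Fin N) : ℝ := if S.G.Adj i j then 1 else 0

/-- Value at time `t` of the model `ż = A z` started at time `σ` from `v`. -/
def hold (σ t : ℝ) (v : Fin n → ℝ) : Fin n → ℝ := NormedSpace.exp ((t - σ) • S.A) *ᵥ v

/-- The triggering function of agent `i` at time `t`, as a function of the current coupling gains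
`c`, of the current observer state `χi` of agent `i`, and of the held estimates `w j` that are
used in the test; the measurement error is `w i - χi`. -/
def trigger (t : ℝ) (c : Fin N → Fin N → ℝ) (i : Fin N) (χi : Fin n → ℝ)
    (w : Fin N → Fin n → ℝ) : ℝ :=
  ∑ j, (1 + S.δ * c i j) * S.a i j * quad S.Γ (w i - χi)
    - 1 / 4 * ∑ j, S.a i j * quad S.Γ (w i - w j)
    - S.μ * Real.exp (-S.ν * t)

/-- The protocol's constants are those constructed by the design algorithm: `A + F C` is Hurwitz,
`K = -Bᵀ P` and `Γ = P B Bᵀ P` for a positive definite solution `P` of the algebraic Riccati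
equation, and all scalar constants are positive (symmetric in the edge). -/
structure IsDesigned : Prop where
  hurwitz : IsHurwitz (S.A + S.F * S.C)
  riccati : ∃ P : Matrix (Fin n) (Fin n) ℝ, P.PosDef ∧
    P * S.A + S.Aᵀ * P - P * S.B * S.Bᵀ * P + 1 = 0 ∧
    S.K = -(S.Bᵀ * P) ∧ S.Γ = P * S.B * S.Bᵀ * P
  κ_pos : ∀ i j, S.G.Adj i j → 0 < S.κ i j
  κ_symm : ∀ i j, S.G.Adj i j → S.κ i j = S.κ j i
  ϱ_pos : ∀ i j, S.G.Adj i j → 0 < S.ϱ i j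
  ϱ_symm : ∀ i j, S.G.Adj i j → S.ϱ i j = S.ϱ j i
  δ_pos : 0 < S.δ
  μ_pos : 0 < S.μ
  ν_pos : 0 < S.ν

end Loop

/-- The signals of a run of the network on the time interval `[0, T)`, where `0 < T ≤ ∞`:
agent states `x`, observer states `χ`, coupling gains `c`, and for every agent `i` the set
`E i = {t₀ⁱ < t₁ⁱ < ⋯}` of its triggering instants in `[0, T)`. -/
structure Run (N n : ℕ) where
  T : EReal
  x : ℝ → Fin N → Fin n → ℝ
  χ : ℝ → Fin N → Fin n → ℝ
  c : ℝ → Fin N → Fin N → ℝ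
  E : Fin N → Set ℝ

namespace Run

variable {N n p q : ℕ} (S : Loop N n p q) (r : Run N n)

/-- The time interval `[0, T)`. -/
def dom : Set ℝ := {t | 0 ≤ t ∧ (t : EReal) < r.T}

/-- The held estimate `χ̃_i(t) = e^{A (t - t_k)} χ_i(t_k)`, with `t_k` the latest triggering
instant of agent `i` that is at most `t` (so an event at time `t` has already been taken into
account). -/
def held (t : ℝ) (i : Fin N) : Fin n → ℝ :=
  S.hold (sSup (r.E i ∩ Set.Iic t)) t (r.χ (sSup (r.E i ∩ Set.Iic t)) i)

/-- The value of the held estimate at time `t` before a possible update at time `t`: here `t_k`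
is the latest triggering instant of agent `i` before `t`. -/
def heldPre (t : ℝ) (i : Fin N) : Fin n → ℝ :=
  S.hold (sSup (r.E i ∩ Set.Iio t)) t (r.χ (sSup (r.E i ∩ Set.Iio t)) i)

/-- The control input of agent `i`. -/
def input (t : ℝ) (i : Fin N) : Fin p → ℝ :=
  S.K *ᵥ ∑ j, (r.c t i j * S.a i j) • (r.held S t i - r.held S t j)

/-- `r` is a trajectory of the closed loop on `[0, T)`: the events do not accumulate before `T`
(they may accumulate at `T`), the differential equations hold, and the events are generated by
the triggering functions. -/
structure IsExecution : Prop where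
  T_pos : 0 < r.T
  E_sub : ∀ i, r.E i ⊆ r.dom
  zero_mem : ∀ i, (0 : ℝ) ∈ r.E i
  E_locFin : ∀ i, ∀ t ∈ r.dom, (r.E i ∩ Set.Iic t).Finite
  c_symm : ∀ i j, S.G.Adj i j → r.c 0 i j = r.c 0 j i
  x_cont : ContinuousOn r.x r.dom
  χ_cont : ContinuousOn r.χ r.dom
  c_cont : ContinuousOn r.c r.dom
  -- The right-hand sides jump at the events, so the derivatives are right derivatives.
  x_ode : ∀ t ∈ r.dom, ∀ i, HasDerivWithinAt (fun s => r.x s i)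
    (S.A *ᵥ r.x t i + S.B *ᵥ r.input S t i) (Set.Ici t) t
  χ_ode : ∀ t ∈ r.dom, ∀ i, HasDerivWithinAt (fun s => r.χ s i)
    (S.A *ᵥ r.χ t i + S.B *ᵥ r.input S t i + S.F *ᵥ (S.C *ᵥ r.χ t i - S.C *ᵥ r.x t i))
    (Set.Ici t) t
  c_ode : ∀ t ∈ r.dom, ∀ i j, HasDerivWithinAt (fun s => r.c s i j)
    (S.κ i j * S.a i j *
      (-S.ϱ i j * r.c t i j + quad S.Γ (r.held S t i - r.held S t j))) (Set.Ici t) t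
  -- No event is missed: `f_i < 0` from one event of agent `i` up to its next one.
  trigger_neg : ∀ t ∈ r.dom, ∀ i, S.trigger t (r.c t) i (r.χ t i) (r.held S t) < 0
  -- Agent `i` triggers only when `f_i ≥ 0`, tested before its own reset. If neighbours trigger at
  -- the same instant, the test may see their estimates before or after their update, so that
  -- every order of processing simultaneous events is covered; otherwise both values agree.
  event : ∀ i, ∀ t ∈ r.E i, 0 < t → ∃ w : Fin N → Fin n → ℝ,
    w i = r.heldPre S t i ∧ (∀ j, w j = r.heldPre S t j ∨ w j = r.held S t j) ∧
    0 ≤ S.trigger t (r.c t) i (r.χ t i) w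

/-- The consensus error: its `i`-th block is `x_i - (1/N) ∑_j x_j`. -/
def consensusError (t : ℝ) (i : Fin N) : Fin n → ℝ :=
  r.x t i - (1 / (N : ℝ)) • ∑ j, r.x t j

/-- Size of the state of the closed-loop error system at time `t`: consensus error, observation
errors `χ_i - x_i`, measurement errors `e_i = χ̃_i - χ_i`, and coupling gains of the edges. -/
def stateSize (t : ℝ) : ℝ :=
  stackNorm (r.consensusError t) + stackNorm (fun i => r.χ t i - r.x t i)
    + stackNorm (fun i => r.held S t i - r.χ t i) + ∑ i, ∑ j, S.a i j * |r.c t i j|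

end Run

/-- The quantity `y` is (globally) uniformly ultimately bounded along the executions of `S`: there
is an ultimate bound `b`, the same for all executions, such that for every `a`, after a time `τ`
that depends only on `a`, the quantity stays within `b` whenever the state was within `a` at some
time `t₀`. -/
def IsUUB {N n p q : ℕ} (S : Loop N n p q) (y : Run N n → ℝ → ℝ) : Prop :=
  ∃ b : ℝ, 0 < b ∧ ∀ a : ℝ, 0 < a → ∃ τ : ℝ, 0 ≤ τ ∧
    ∀ r : Run N n, r.IsExecution S → ∀ t₀ ∈ r.dom, r.stateSize S t₀ ≤ a →
      ∀ t ∈ r.dom, t₀ + τ ≤ t → |y r t| ≤ b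

/-- No Zeno behavior: in no execution, whatever its interval of definition `[0, T)`, does an agent
have infinitely many events within a finite period of time. -/
def NoZeno {N n p q : ℕ} (S : Loop N n p q) : Prop :=
  ∀ r : Run N n, r.IsExecution S → ∀ i, ∀ τ : ℝ, (r.E i ∩ Set.Iio τ).Finite

end EventConsensus

end

/-! The observation errors satisfy the autonomous Hurwitz system with matrix `A + F C`, so they
decay and act on the rest as a bounded, vanishing disturbance. Everything else is measured by
`Loop.lyap`: gain deviations `(c_ij - α)² / (4 κ_ij)`, the `P`-energy of the disagreement of the
observer states, and the `P`-energy of the measurement errors `e_i`. Including `e_i` is what makes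
the bounds uniform in the size of the full state; it is harmless because an event can only reset
this term to zero. The function is thus lower semicontinuous in time, with right derivatives
everywhere, and a Grönwall inequality for such functions (`le_exp_of_deriv_right_le`) applies across
events.

The core is `coupling_dissipation`. By the Riccati equation only the outputs `Bᵀ P v` can produce
growth. The terms quadratic in edge differences and weighted by `c_ij` cancel between feedback,
cross terms and adaptation. What is left is absorbed by a large `α`, through a Poincaré inequality
on the connected graph and the triggering condition.

Gains may start negative, which spoils the signs. Since the adaptation drives them up, their
negative part is at most `a e^{-ρ(t-t₀)}`. During a time depending on `a`, the Lyapunov function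
grows at most exponentially (`exists_lyap_le_of_le_add`); afterwards the negative part is small
enough to be absorbed and the decay has constants free of `a` (`exists_ultimate_lyap_le`).

For Zeno behavior, on a bounded time interval the Lyapunov bound also bounds the velocity of `e_i`.
Since `e_i` restarts from zero at each event and must reach a size bounded below by a multiple of `μ
e^{-νt}` in the triggering function, consecutive events of an agent keep a positive distance. -/

open scoped Matrix

noncomputable section

namespace EventConsensus

open Filter Topology Set

/-! ### Comparison principles for functions with downward jumps. -/

/-- A lower semicontinuous function with right derivatives stays below a differentiable barrier
if it starts below and grows strictly slower wherever it touches the barrier. -/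
theorem le_of_lowerSemicontinuousOn_of_deriv_right_lt {f f' B B' : ℝ → ℝ} {a b : ℝ} (hab : a ≤ b)
    (hf : LowerSemicontinuousOn f (Icc a b)) (hB : ∀ t, HasDerivAt B (B' t) t)
    (ha : f a ≤ B a)
    (hf' : ∀ t ∈ Ico a b, HasDerivWithinAt f (f' t) (Ici t) t)
    (hlt : ∀ t ∈ Ico a b, f t = B t → f' t < B' t) : f b ≤ B b := by
  have hBc : Continuous B := continuous_iff_continuousAt.2 fun t => (hB t).continuousAt
  have hg : LowerSemicontinuousOn (fun t => f t + -B t) (Icc a b) :=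
    hf.add hBc.neg.continuousOn.lowerSemicontinuousOn
  -- Continuous induction: semicontinuity makes the set where the barrier holds closed, and the
  -- right derivative extends it to the right of each of its points.
  have hsub := IsClosed.Icc_subset_of_forall_exists_gt (a := a) (b := b) (s := {t | f t ≤ B t})
    ?_ ha ?_
  · exact hsub ⟨hab, le_rfl⟩
  · obtain ⟨v, hv, hv'⟩ := lowerSemicontinuousOn_iff_preimage_Iic.1 hg 0
    have : {t | f t ≤ B t} ∩ Icc a b = Icc a b ∩ v := by
      rw [← hv']
      ext t
      simp only [mem_inter_iff, mem_ofPred_eq, mem_preimage, mem_Iic]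
      constructor
      · rintro ⟨h1, h2⟩; exact ⟨h2, by linarith⟩
      · rintro ⟨h1, h2⟩; exact ⟨by linarith, h1⟩
    rw [this]
    exact isClosed_Icc.inter hv
  · rintro t ⟨ht, htI⟩ y hy
    have key : ∀ᶠ z in 𝓝[>] t, f z ≤ B z := by
      rcases lt_or_eq_of_le (show f t ≤ B t from ht) with h | h
      · have h1 : ContinuousWithinAt (fun z => f z - B z) (Ici t) t :=
          (hf' t htI).continuousWithinAt.sub hBc.continuousWithinAt
        have h2 : ∀ᶠ z in 𝓝[Ici t] t, f z - B z < 0 :=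
          h1.eventually (gt_mem_nhds (by simpa using h))
        filter_upwards [nhdsWithin_mono t Ioi_subset_Ici_self h2] with z hz
        linarith
      · have h1 : HasDerivWithinAt (fun z => f z - B z) (f' t - B' t) (Ioi t) t :=
          ((hf' t htI).sub (hB t).hasDerivWithinAt).mono Ioi_subset_Ici_self
        rw [hasDerivWithinAt_iff_tendsto_slope' (by simp)] at h1
        filter_upwards [h1.eventually (gt_mem_nhds (sub_neg.2 (hlt t htI h))), self_mem_nhdsWithin]
          with z hz hz'
        rw [slope_def_field, div_lt_iff₀ (sub_pos.2 hz')] at hz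
        linarith
    obtain ⟨z, hz1, hz2⟩ := (key.and (Ioc_mem_nhdsGT hy)).exists
    exact ⟨z, hz1, hz2⟩

/-- Grönwall's inequality for lower semicontinuous functions with right derivatives. -/
theorem le_exp_of_deriv_right_le {f f' : ℝ → ℝ} {a b l C : ℝ} (hl : l ≠ 0) (hab : a ≤ b)
    (hf : LowerSemicontinuousOn f (Icc a b))
    (hf' : ∀ t ∈ Ico a b, HasDerivWithinAt f (f' t) (Ici t) t)
    (hle : ∀ t ∈ Ico a b, f' t ≤ -l * f t + C) :
    f b ≤ (f a - C / l) * Real.exp (-l * (b - a)) + C / l := by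
  -- Raising `C` to `C + η` turns the solution of the linear equation into a strict barrier; then `η
  -- → 0`. The sign of `l` is free, so the same bound serves for growth and for decay.
  have key : ∀ η : ℝ, 0 < η →
      f b ≤ (f a - (C + η) / l) * Real.exp (-l * (b - a)) + (C + η) / l := by
    intro η hη
    refine le_of_lowerSemicontinuousOn_of_deriv_right_lt
      (B := fun t => (f a - (C + η) / l) * Real.exp (-l * (t - a)) + (C + η) / l)
      (B' := fun t => (f a - (C + η) / l) * (Real.exp (-l * (t - a)) * (-l)))
      hab hf (fun t => ?_) (by simp) hf' (fun t ht h => ?_)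
    · have h1 : HasDerivAt (fun t => -l * (t - a)) (-l) t := by
        simpa using ((hasDerivAt_id t).sub_const a).const_mul (-l)
      exact (h1.exp.const_mul _).add_const _
    · have h1 := hle t ht
      have h2 : (f a - (C + η) / l) * Real.exp (-l * (t - a)) = f t - (C + η) / l := by
        rw [h]; ring
      have h3 : l * ((C + η) / l) = C + η := by field_simp
      calc f' t ≤ -l * f t + C := h1
        _ < -l * (f t - (C + η) / l) := by linarith
        _ = _ := by rw [← h2]; ring
  have hlim : Tendsto (fun η : ℝ => (f a - (C + η) / l) * Real.exp (-l * (b - a)) + (C + η) / l)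
      (𝓝[>] 0) (𝓝 ((f a - (C + 0) / l) * Real.exp (-l * (b - a)) + (C + 0) / l)) := by
    refine (Continuous.tendsto ?_ 0).mono_left nhdsWithin_le_nhds
    fun_prop
  rw [add_zero] at hlim
  exact ge_of_tendsto hlim (by filter_upwards [self_mem_nhdsWithin] with η hη using key η hη)

/-! ### Matrix exponentials and decay for Hurwitz matrices. -/

section MatrixExp

open scoped Matrix.Norms.Operator

variable {n : ℕ}

theorem hasDerivAt_exp_sub_smul_mulVec (M : Matrix (Fin n) (Fin n) ℝ) (σ t : ℝ) (v : Fin n → ℝ) :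
    HasDerivAt (fun s : ℝ => NormedSpace.exp ((s - σ) • M) *ᵥ v)
      (M *ᵥ (NormedSpace.exp ((t - σ) • M) *ᵥ v)) t := by
  have h := (hasDerivAt_exp_smul_const' (𝕂 := ℝ) M (t - σ)).scomp t
    ((hasDerivAt_id t).sub_const σ)
  rw [one_smul] at h
  let φ : Matrix (Fin n) (Fin n) ℝ →ₗ[ℝ] (Fin n → ℝ) :=
    { toFun := fun X => X *ᵥ v
      map_add' := fun X Y => Matrix.add_mulVec X Y v
      map_smul' := fun c X => Matrix.smul_mulVec c X v }
  have h2 := (LinearMap.toContinuousLinearMap φ).hasFDerivAt.comp_hasDerivAt t h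
  rw [Matrix.mulVec_mulVec]
  exact h2

/-- Split `M = z + D` into commuting parts; on a generalized eigenvector the exponential series of
`D` stops before the power `k`. -/
theorem exp_smul_mulVec_eq_sum {n : ℕ} (M : Matrix (Fin n) (Fin n) ℂ) (z : ℂ) (k : ℕ)
    (v : Fin n → ℂ) (hv : ((M - z • 1) ^ k) *ᵥ v = 0) (t : ℝ) :
    NormedSpace.exp ((t : ℂ) • M) *ᵥ v =
      ∑ j ∈ Finset.range k, (Complex.exp (t * z) * ((j.factorial : ℂ)⁻¹ * (t : ℂ) ^ j)) •
        (((M - z • 1) ^ j) *ᵥ v) := by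
  set D := M - z • (1 : Matrix (Fin n) (Fin n) ℂ) with hD
  have hsplit : (t : ℂ) • M = ((t : ℂ) * z) • (1 : Matrix (Fin n) (Fin n) ℂ) + (t : ℂ) • D := by
    rw [hD, smul_sub, smul_smul]; abel
  have hcomm : Commute (((t : ℂ) * z) • (1 : Matrix (Fin n) (Fin n) ℂ)) ((t : ℂ) • D) :=
    (Commute.one_left _).smul_left _
  have hdiag : NormedSpace.exp (((t : ℂ) * z) • (1 : Matrix (Fin n) (Fin n) ℂ)) =
      Complex.exp (t * z) • 1 := by
    have := NormedSpace.algebraMap_exp_comm (𝕂 := ℂ) (𝔸 := Matrix (Fin n) (Fin n) ℂ) ((t : ℂ) * z)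
    rw [Algebra.algebraMap_eq_smul_one, Algebra.algebraMap_eq_smul_one] at this
    rw [Complex.exp_eq_exp_ℂ]
    exact this.symm
  let φ : Matrix (Fin n) (Fin n) ℂ →ₗ[ℂ] (Fin n → ℂ) :=
    { toFun := fun X => X *ᵥ v
      map_add' := fun X Y => Matrix.add_mulVec X Y v
      map_smul' := fun c X => Matrix.smul_mulVec c X v }
  have hs := (LinearMap.toContinuousLinearMap φ).hasSum
    (NormedSpace.exp_series_hasSum_exp' (𝕂 := ℂ) ((t : ℂ) • D))
  have hs2 : HasSum (fun j : ℕ => ((j.factorial : ℂ)⁻¹ * (t : ℂ) ^ j) • ((D ^ j) *ᵥ v))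
      (NormedSpace.exp ((t : ℂ) • D) *ᵥ v) := by
    convert! hs using 2 with j
    rw [smul_pow, smul_smul]
    exact (Matrix.smul_mulVec _ _ _).symm
  have hz : ∀ j ∉ Finset.range k, ((j.factorial : ℂ)⁻¹ * (t : ℂ) ^ j) • ((D ^ j) *ᵥ v) = 0 := by
    intro j hj
    obtain ⟨l, rfl⟩ := Nat.exists_eq_add_of_le (not_lt.1 (by simpa using hj))
    rw [add_comm k l, pow_add D, ← Matrix.mulVec_mulVec, hv, Matrix.mulVec_zero, smul_zero]
  have hs3 := hs2.unique (hasSum_sum_of_ne_finset_zero hz)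
  rw [hsplit, Matrix.exp_add_of_commute _ _ hcomm, hdiag, smul_mul_assoc, one_mul,
    Matrix.smul_mulVec, hs3, Finset.smul_sum]
  exact Finset.sum_congr rfl fun j _ => smul_smul _ _ _

theorem tendsto_exp_mul_pow {z : ℂ} (hz : z.re < 0) (c : ℂ) (j : ℕ) :
    Tendsto (fun t : ℝ => Complex.exp (t * z) * (c * (t : ℂ) ^ j)) atTop (𝓝 0) := by
  have h1 := (tendsto_rpow_mul_exp_neg_mul_atTop_nhds_zero j (-z.re) (by linarith)).const_mul ‖c‖
  rw [mul_zero] at h1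
  refine tendsto_zero_iff_norm_tendsto_zero.2 (h1.congr' ?_)
  filter_upwards [eventually_ge_atTop 0] with t ht
  simp only [norm_mul, norm_pow, Complex.norm_exp, Complex.norm_real, Real.norm_eq_abs,
    abs_of_nonneg ht, Real.rpow_natCast]
  simp
  ring_nf

/-- The exponential of a Hurwitz matrix decays. -/
theorem IsHurwitz.tendsto_exp {M : Matrix (Fin n) (Fin n) ℝ} (hM : IsHurwitz M) :
    Tendsto (fun t : ℝ => NormedSpace.exp (t • M)) atTop (𝓝 0) := by
  set MC := M.map (algebraMap ℝ ℂ) with hMC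
  have hvec : ∀ v : Fin n → ℂ,
      Tendsto (fun t : ℝ => NormedSpace.exp ((t : ℂ) • MC) *ᵥ v) atTop (𝓝 0) := by
    intro v
    -- Over `ℂ` the generalized eigenspaces span, so decay need only be checked on generalized
    -- eigenvectors, where it is `e^{tz}` against a polynomial.
    have hv : v ∈ ⨆ z, Module.End.maxGenEigenspace (Matrix.toLin' MC) z := by
      rw [Module.End.iSup_maxGenEigenspace_eq_top]; trivial
    refine Submodule.iSup_induction _ (motive := fun v : Fin n → ℂ =>
      Tendsto (fun t : ℝ => NormedSpace.exp ((t : ℂ) • MC) *ᵥ v) atTop (𝓝 0)) hv ?_ ?_ ?_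
    · intro z x hx
      by_cases hx0 : x = 0
      · simp [hx0]
      obtain ⟨k, hk⟩ := (Module.End.mem_maxGenEigenspace _ _ _).1 hx
      have hz : z.re < 0 := by
        apply hM
        rw [← Matrix.spectrum_toLin', ← Module.End.hasEigenvalue_iff_mem_spectrum]
        have hne : Module.End.maxGenEigenspace (Matrix.toLin' MC) z ≠ ⊥ := by
          intro h
          rw [h] at hx
          exact hx0 (by simpa using hx)
        -- If `M - z` were injective, so would be its powers, and the generalized eigenspace would
        -- vanish.
        refine Module.End.hasEigenvalue_iff.2 fun h => hne ?_
        refine (Submodule.eq_bot_iff _).2 fun y hy => ?_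
        obtain ⟨k, hk⟩ := (Module.End.mem_maxGenEigenspace _ _ _).1 hy
        induction k with
        | zero => simpa using hk
        | succ k ih =>
          apply ih
          rw [pow_succ', Module.End.mul_apply] at hk
          have : ((Matrix.toLin' MC - z • 1) ^ k) y ∈ Module.End.eigenspace (Matrix.toLin' MC) z := by
            rw [Module.End.mem_eigenspace_iff]
            simpa [sub_eq_zero] using hk
          rw [h] at this
          simpa using this
      have hk' : ((MC - z • 1) ^ k) *ᵥ x = 0 := by
        rw [← Matrix.toLin'_apply, Matrix.toLin'_pow, map_sub, map_smul, Matrix.toLin'_one]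
        exact hk
      simp only [exp_smul_mulVec_eq_sum MC z k x hk']
      rw [show (0 : Fin n → ℂ) = ∑ j ∈ Finset.range k, (0 : ℂ) • (((MC - z • 1) ^ j) *ᵥ x) by simp]
      exact tendsto_finsetSum _ fun j _ => (tendsto_exp_mul_pow hz _ j).smul_const _
    · simp
    · intro x y hx hy
      simpa [Matrix.mulVec_add] using hx.add hy
  have hmap : ∀ t : ℝ, (NormedSpace.exp (t • M)).map (algebraMap ℝ ℂ) =
      NormedSpace.exp ((t : ℂ) • MC) := by
    intro t
    have := NormedSpace.map_exp ((algebraMap ℝ ℂ).mapMatrix (m := Fin n))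
      (Continuous.matrix_map continuous_id Complex.continuous_ofReal) (t • M)
    simp only [RingHom.mapMatrix_apply] at this
    have h2 : (t • M).map (algebraMap ℝ ℂ) = (t : ℂ) • MC := by
      ext i j
      simp [MC]
    rw [h2] at this
    exact this
  refine tendsto_pi_nhds.2 fun i => tendsto_pi_nhds.2 fun j => ?_
  have h1 := tendsto_pi_nhds.1 (hvec (Pi.single j 1)) i
  have h2 := (Complex.continuous_re.tendsto _).comp h1
  refine (h2.congr fun t => ?_)
  have h3 : NormedSpace.exp ((t : ℂ) • MC) i j = ((NormedSpace.exp (t • M) i j : ℝ) : ℂ) :=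
    (congrFun (congrFun (hmap t) i) j).symm
  simp only [Function.comp_apply, Matrix.mulVec_single_one, Matrix.col_apply]
  exact (congrArg Complex.re h3).trans (Complex.ofReal_re _)

end MatrixExp

/-! ### Quadratic forms, Frobenius bounds and deviations from the mean. -/

section Vectors

variable {m n : ℕ}

theorem dotProduct_self_nonneg' (v : Fin n → ℝ) : 0 ≤ v ⬝ᵥ v :=
  Finset.sum_nonneg fun i _ => mul_self_nonneg (v i)

theorem dotProduct_add_self (v w : Fin n → ℝ) :
    (v + w) ⬝ᵥ (v + w) = v ⬝ᵥ v + 2 * (v ⬝ᵥ w) + w ⬝ᵥ w := by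
  rw [add_dotProduct, dotProduct_add, dotProduct_add, dotProduct_comm w v]; ring

theorem dotProduct_sub_self (v w : Fin n → ℝ) :
    (v - w) ⬝ᵥ (v - w) = v ⬝ᵥ v - 2 * (v ⬝ᵥ w) + w ⬝ᵥ w := by
  rw [sub_dotProduct, dotProduct_sub, dotProduct_sub, dotProduct_comm w v]; ring

theorem two_mul_abs_dotProduct_le (v w : Fin n → ℝ) : 2 * |v ⬝ᵥ w| ≤ v ⬝ᵥ v + w ⬝ᵥ w := by
  have h1 := dotProduct_self_nonneg' (v + w)
  have h2 := dotProduct_self_nonneg' (v - w)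
  rw [dotProduct_add_self] at h1
  rw [dotProduct_sub_self] at h2
  rcases abs_cases (v ⬝ᵥ w) with ⟨h, _⟩ | ⟨h, _⟩ <;> linarith

theorem dotProduct_add_self_le (v w : Fin n → ℝ) :
    (v + w) ⬝ᵥ (v + w) ≤ 2 * (v ⬝ᵥ v) + 2 * (w ⬝ᵥ w) := by
  have h := two_mul_abs_dotProduct_le v w
  have := le_abs_self (v ⬝ᵥ w)
  rw [dotProduct_add_self]; linarith

theorem dotProduct_sub_self_le (v w : Fin n → ℝ) :
    (v - w) ⬝ᵥ (v - w) ≤ 2 * (v ⬝ᵥ v) + 2 * (w ⬝ᵥ w) := by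
  have h := two_mul_abs_dotProduct_le v w
  have := neg_abs_le (v ⬝ᵥ w)
  rw [dotProduct_sub_self]; linarith

/-- Square of the Frobenius norm. -/
def frobSq (X : Matrix (Fin m) (Fin n) ℝ) : ℝ := ∑ i, ∑ j, X i j ^ 2

theorem frobSq_nonneg (X : Matrix (Fin m) (Fin n) ℝ) : 0 ≤ frobSq X :=
  Finset.sum_nonneg fun _ _ => Finset.sum_nonneg fun _ _ => sq_nonneg _

theorem mulVec_dotProduct_self_le (X : Matrix (Fin m) (Fin n) ℝ) (v : Fin n → ℝ) :
    (X *ᵥ v) ⬝ᵥ (X *ᵥ v) ≤ frobSq X * (v ⬝ᵥ v) := by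
  rw [frobSq, Finset.sum_mul]
  refine Finset.sum_le_sum fun i _ => ?_
  have h := Finset.sum_mul_sq_le_sq_mul_sq Finset.univ (X i) v
  have h2 : v ⬝ᵥ v = ∑ j, v j ^ 2 := Finset.sum_congr rfl fun j _ => (sq (v j)).symm
  rw [← sq, h2]
  exact h

theorem quad_le (X : Matrix (Fin n) (Fin n) ℝ) (v : Fin n → ℝ) :
    quad X v ≤ (1 + frobSq X) * (v ⬝ᵥ v) := by
  have h1 := two_mul_abs_dotProduct_le v (X *ᵥ v)
  have h2 := mulVec_dotProduct_self_le X v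
  have h3 := le_abs_self (v ⬝ᵥ (X *ᵥ v))
  have h4 := mul_nonneg (frobSq_nonneg X) (dotProduct_self_nonneg' v)
  have h5 := dotProduct_self_nonneg' v
  unfold quad
  nlinarith

theorem dotProduct_mulVec_symm {P : Matrix (Fin n) (Fin n) ℝ} (hP : Pᵀ = P) (v w : Fin n → ℝ) :
    v ⬝ᵥ (P *ᵥ w) = w ⬝ᵥ (P *ᵥ v) := by
  rw [Matrix.dotProduct_mulVec, ← Matrix.mulVec_transpose, hP, dotProduct_comm]

theorem _root_.Matrix.PosDef.transpose_eq {P : Matrix (Fin n) (Fin n) ℝ} (hP : P.PosDef) :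
    Pᵀ = P := by
  have := hP.isHermitian
  rwa [Matrix.IsHermitian, Matrix.conjTranspose_eq_transpose_of_trivial] at this

theorem quad_nonneg_of_posDef {P : Matrix (Fin n) (Fin n) ℝ} (hP : P.PosDef) (v : Fin n → ℝ) :
    0 ≤ quad P v := by
  simpa [quad] using hP.posSemidef.dotProduct_mulVec_nonneg v

/-- Expanding `0 ≤ quad P (C v - P⁻¹ v)` gives `2 C |v|² ≤ C² quad P v + quad P⁻¹ v`, and `C` is
chosen so that the last term is at most `C |v|²`. This avoids eigenvalues. -/
theorem exists_le_quad_of_posDef {P : Matrix (Fin n) (Fin n) ℝ} (hP : P.PosDef) :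
    ∃ C : ℝ, 0 < C ∧ ∀ v, v ⬝ᵥ v ≤ C * quad P v := by
  refine ⟨1 + frobSq P⁻¹, by linarith [frobSq_nonneg P⁻¹], fun v => ?_⟩
  set C := 1 + frobSq P⁻¹ with hC
  have hC0 : 0 < C := by linarith [frobSq_nonneg P⁻¹]
  have hPz : P *ᵥ (P⁻¹ *ᵥ v) = v := by
    rw [Matrix.mulVec_mulVec, Matrix.mul_nonsing_inv _ ((Matrix.isUnit_iff_isUnit_det _).1 hP.isUnit),
      Matrix.one_mulVec]
  have h1 := quad_nonneg_of_posDef hP (C • v - P⁻¹ *ᵥ v)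
  have h2 : quad P (C • v - P⁻¹ *ᵥ v) = C ^ 2 * quad P v - 2 * C * (v ⬝ᵥ v) + quad P⁻¹ v := by
    have h3 := dotProduct_mulVec_symm hP.transpose_eq (P⁻¹ *ᵥ v) v
    rw [hPz] at h3
    simp only [quad, Matrix.mulVec_sub, Matrix.mulVec_smul, hPz, sub_dotProduct, dotProduct_sub,
      smul_dotProduct, dotProduct_smul, smul_eq_mul, h3, dotProduct_comm (P⁻¹ *ᵥ v) v]
    ring
  have h4 := quad_le P⁻¹ v
  have h5 : C * (v ⬝ᵥ v) ≤ C * (C * quad P v) := by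
    rw [h2] at h1
    nlinarith
  exact le_of_mul_le_mul_left h5 hC0

theorem _root_.HasDerivWithinAt.mulVec {v : ℝ → Fin n → ℝ} {v' : Fin n → ℝ} {s : Set ℝ} {t : ℝ}
    (X : Matrix (Fin m) (Fin n) ℝ) (hv : HasDerivWithinAt v v' s t) :
    HasDerivWithinAt (fun r => X *ᵥ v r) (X *ᵥ v') s t :=
  (LinearMap.toContinuousLinearMap X.mulVecLin).hasFDerivAt.comp_hasDerivWithinAt t hv

theorem _root_.HasDerivWithinAt.dotProduct {v w : ℝ → Fin n → ℝ} {v' w' : Fin n → ℝ} {s : Set ℝ}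
    {t : ℝ} (hv : HasDerivWithinAt v v' s t) (hw : HasDerivWithinAt w w' s t) :
    HasDerivWithinAt (fun r => v r ⬝ᵥ w r) (v' ⬝ᵥ w t + v t ⬝ᵥ w') s t := by
  have h := HasDerivWithinAt.fun_sum (u := Finset.univ) fun i _ =>
    (hasDerivWithinAt_pi.1 hv i).mul (hasDerivWithinAt_pi.1 hw i)
  simpa only [_root_.dotProduct, ← Finset.sum_add_distrib] using! h

theorem _root_.HasDerivWithinAt.quad {P : Matrix (Fin n) (Fin n) ℝ} (hP : Pᵀ = P)
    {v : ℝ → Fin n → ℝ} {v' : Fin n → ℝ} {s : Set ℝ}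
    {t : ℝ} (hv : HasDerivWithinAt v v' s t) :
    HasDerivWithinAt (fun r => EventConsensus.quad P (v r)) (2 * (v t ⬝ᵥ (P *ᵥ v'))) s t := by
  have h := hv.dotProduct (hv.mulVec P)
  rw [dotProduct_mulVec_symm hP v', ← two_mul] at h
  exact h

theorem continuous_quad (P : Matrix (Fin n) (Fin n) ℝ) : Continuous (quad P) := by
  unfold quad
  fun_prop

theorem abs_apply_le_sqrt (v : Fin n → ℝ) (l : Fin n) : |v l| ≤ Real.sqrt (v ⬝ᵥ v) := by
  rw [← Real.sqrt_sq_eq_abs]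
  apply Real.sqrt_le_sqrt
  rw [sq]
  exact Finset.single_le_sum (f := fun i => v i * v i) (fun i _ => mul_self_nonneg (v i))
    (Finset.mem_univ l)

theorem stackNorm_eq {N : ℕ} (v : Fin N → Fin n → ℝ) :
    stackNorm v = Real.sqrt (∑ i, v i ⬝ᵥ v i) := by
  simp only [stackNorm, dotProduct, sq]

theorem stackNorm_nonneg {N : ℕ} (v : Fin N → Fin n → ℝ) : 0 ≤ stackNorm v := Real.sqrt_nonneg _

theorem sum_dotProduct_self_nonneg {N : ℕ} (v : Fin N → Fin n → ℝ) : 0 ≤ ∑ i, v i ⬝ᵥ v i :=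
  Finset.sum_nonneg fun i _ => dotProduct_self_nonneg' (v i)

theorem stackNorm_sq {N : ℕ} (v : Fin N → Fin n → ℝ) :
    stackNorm v ^ 2 = ∑ i, v i ⬝ᵥ v i := by
  rw [stackNorm_eq, Real.sq_sqrt (sum_dotProduct_self_nonneg v)]

/-- Deviation of a family of vectors from its mean. -/
def dev {N : ℕ} (v : Fin N → Fin n → ℝ) (i : Fin N) : Fin n → ℝ :=
  v i - (1 / (N : ℝ)) • ∑ j, v j

theorem sum_dev {N : ℕ} (v : Fin N → Fin n → ℝ) : ∑ i, dev v i = 0 := by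
  rcases Nat.eq_zero_or_pos N with rfl | hN
  · simp
  have : (N : ℝ) ≠ 0 := by positivity
  simp only [dev, Finset.sum_sub_distrib, Finset.sum_const, Finset.card_univ, Fintype.card_fin,
    ← Nat.cast_smul_eq_nsmul ℝ, smul_smul]
  rw [mul_one_div_cancel this, one_smul, sub_self]

theorem dev_sub {N : ℕ} (v w : Fin N → Fin n → ℝ) (i : Fin N) :
    dev (fun j => v j - w j) i = dev v i - dev w i := by
  simp only [dev, Finset.sum_sub_distrib, smul_sub]
  abel

/-- Deviations sum to zero, so a vector common to all agents is invisible to them. This removes the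
mean from the derivative of the disagreement energy. -/
theorem sum_dev_dotProduct_sub {N : ℕ} (v : Fin N → Fin n → ℝ) (u : Fin N → Fin n → ℝ)
    (w : Fin n → ℝ) : ∑ i, dev v i ⬝ᵥ (u i - w) = ∑ i, dev v i ⬝ᵥ u i := by
  simp only [dotProduct_sub, Finset.sum_sub_distrib, ← sum_dotProduct, sum_dev, zero_dotProduct,
    sub_zero]

theorem mulVec_dev {N : ℕ} (X : Matrix (Fin m) (Fin n) ℝ) (v : Fin N → Fin n → ℝ) (i : Fin N) :
    X *ᵥ dev v i = dev (fun j => X *ᵥ v j) i := by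
  simp only [dev, Matrix.mulVec_sub, Matrix.mulVec_smul, Matrix.mulVec_sum]

theorem dev_sub_dev {N : ℕ} (v : Fin N → Fin n → ℝ) (i j : Fin N) :
    dev v i - dev v j = v i - v j := by
  simp [dev]

/-- The mean minimizes the sum of squared distances. -/
theorem sum_dev_sq_le {N : ℕ} (v : Fin N → Fin n → ℝ) (w : Fin n → ℝ) :
    ∑ i, dev v i ⬝ᵥ dev v i ≤ ∑ i, (v i - w) ⬝ᵥ (v i - w) := by
  have h : ∀ i, (v i - w) ⬝ᵥ (v i - w) = dev v i ⬝ᵥ dev v i +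
      2 * (dev v i ⬝ᵥ ((0 : Fin n → ℝ) - (w - (1 / (N : ℝ)) • ∑ j, v j))) +
      (w - (1 / (N : ℝ)) • ∑ j, v j) ⬝ᵥ (w - (1 / (N : ℝ)) • ∑ j, v j) := by
    intro i
    have : v i - w = dev v i + (0 - (w - (1 / (N : ℝ)) • ∑ j, v j)) := by
      simp only [dev]; abel
    rw [this, dotProduct_add_self, zero_sub, neg_dotProduct_neg]
  have h2 := sum_dev_dotProduct_sub v (fun _ => 0) (w - (1 / (N : ℝ)) • ∑ j, v j)
  simp only [h, Finset.sum_add_distrib, ← Finset.mul_sum, h2, dotProduct_zero,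
    Finset.sum_const_zero, mul_zero, add_zero]
  exact le_add_of_nonneg_right (Finset.sum_nonneg fun _ _ => dotProduct_self_nonneg' _)

theorem sum_dev_sq_le_self {N : ℕ} (v : Fin N → Fin n → ℝ) :
    ∑ i, dev v i ⬝ᵥ dev v i ≤ ∑ i, v i ⬝ᵥ v i := by
  simpa using sum_dev_sq_le v 0

end Vectors

/-! ### Uniform bounds and uniqueness for linear systems. -/

section Hurwitz

variable {n : ℕ}

theorem continuous_frobSq_exp (M : Matrix (Fin n) (Fin n) ℝ) :
    Continuous fun t : ℝ => frobSq (NormedSpace.exp (t • M)) := by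
  have h : ∀ i j, Continuous fun t : ℝ => NormedSpace.exp (t • M) i j := by
    intro i j
    refine continuous_iff_continuousAt.2 fun t => ?_
    have h1 := (hasDerivAt_exp_sub_smul_mulVec M 0 t (Pi.single j 1)).continuousAt
    have h2 := (continuous_apply i).continuousAt.comp h1
    simpa [Function.comp_def] using h2
  exact continuous_finsetSum _ fun i _ => continuous_finsetSum _ fun j _ => (h i j).pow 2

theorem IsHurwitz.tendsto_frobSq_exp {M : Matrix (Fin n) (Fin n) ℝ} (hM : IsHurwitz M) :
    Tendsto (fun t : ℝ => frobSq (NormedSpace.exp (t • M))) atTop (𝓝 0) := by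
  have h : ∀ i j, Tendsto (fun t : ℝ => NormedSpace.exp (t • M) i j ^ 2) atTop (𝓝 0) := by
    intro i j
    have h1 := (tendsto_pi_nhds.1 (tendsto_pi_nhds.1 hM.tendsto_exp i) j).pow 2
    rwa [show ((0 : Matrix (Fin n) (Fin n) ℝ) i j) ^ 2 = 0 by simp] at h1
  rw [show (0 : ℝ) = ∑ i : Fin n, ∑ j : Fin n, (0 : ℝ) by simp]
  exact tendsto_finsetSum _ fun i _ => tendsto_finsetSum _ fun j _ => h i j

theorem IsHurwitz.exists_frobSq_exp_le {M : Matrix (Fin n) (Fin n) ℝ} (hM : IsHurwitz M) :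
    ∃ C : ℝ, 0 < C ∧ ∀ t : ℝ, 0 ≤ t → frobSq (NormedSpace.exp (t • M)) ≤ C := by
  obtain ⟨τ, hτ⟩ := eventually_atTop.1 (hM.tendsto_frobSq_exp.eventually (gt_mem_nhds one_pos))
  obtain ⟨C, hC⟩ := isCompact_Icc.bddAbove_image (K := Icc 0 τ) (continuous_frobSq_exp M).continuousOn
  refine ⟨max C 1, by positivity, fun t ht => ?_⟩
  rcases le_total t τ with h | h
  · exact (hC (mem_image_of_mem _ ⟨ht, h⟩)).trans (le_max_left _ _)
  · exact (hτ t h).le.trans (le_max_right _ _)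

/-- Uniqueness for linear systems, with right derivatives. -/
theorem eq_exp_mulVec_of_deriv_right (M : Matrix (Fin n) (Fin n) ℝ) {v : ℝ → Fin n → ℝ} {a b : ℝ}
    (hv : ContinuousOn v (Icc a b))
    (hd : ∀ t ∈ Ico a b, HasDerivWithinAt v (M *ᵥ v t) (Ici t) t) (hab : a ≤ b) :
    v b = NormedSpace.exp ((b - a) • M) *ᵥ v a := by
  have h1 : ContinuousOn (fun t => NormedSpace.exp ((t - a) • M) *ᵥ v a) (Icc a b) :=
    fun t _ => (hasDerivAt_exp_sub_smul_mulVec M a t (v a)).continuousAt.continuousWithinAt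
  have hK : ∀ t ∈ Ico a b, LipschitzOnWith
      ‖LinearMap.toContinuousLinearMap M.mulVecLin‖₊ (fun w => M *ᵥ w) univ :=
    fun t _ => (LinearMap.toContinuousLinearMap M.mulVecLin).lipschitz.lipschitzOnWith
  have h := ODE_solution_unique_of_mem_Icc_right (v := fun _ w => M *ᵥ w) (s := fun _ => univ)
    hK hv hd (fun _ _ => mem_univ _) h1
    (fun t _ => (hasDerivAt_exp_sub_smul_mulVec M a t (v a)).hasDerivWithinAt)
    (fun _ _ => mem_univ _) (by simp)
  exact h ⟨hab, le_rfl⟩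

end Hurwitz

/-! ### A Poincaré inequality on connected graphs. -/

section Graph

variable {N p : ℕ}

/-- A Poincaré inequality: on a connected graph, deviations from the mean are controlled by the
differences along edges. -/
theorem exists_sum_dev_le (G : SimpleGraph (Fin N)) (hG : G.Connected)
    (a : Fin N → Fin N → ℝ) (ha : ∀ i j, G.Adj i j → a i j = 1) (ha0 : ∀ i j, 0 ≤ a i j) :
    ∃ C : ℝ, 0 ≤ C ∧ ∀ y : Fin N → Fin p → ℝ,
      ∑ i, dev y i ⬝ᵥ dev y i ≤ C * ∑ i, ∑ j, a i j * ((y i - y j) ⬝ᵥ (y i - y j)) := by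
  have key : ∀ i j, ∃ C : ℝ, 0 ≤ C ∧ ∀ y : Fin N → Fin p → ℝ, (y i - y j) ⬝ᵥ (y i - y j) ≤
      C * ∑ k, ∑ l, a k l * ((y k - y l) ⬝ᵥ (y k - y l)) := by
    intro i j
    -- Induct along a walk; each added edge costs a factor two from `|u + v|² ≤ 2|u|² + 2|v|²`.
    obtain ⟨w⟩ := hG.preconnected i j
    induction w with
    | nil => exact ⟨0, le_rfl, fun y => by simp⟩
    | @cons u v w huv _ ih =>
      obtain ⟨C, hC, h⟩ := ih
      refine ⟨2 + 2 * C, by positivity, fun y => ?_⟩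
      have h1 := dotProduct_add_self_le (y u - y v) (y v - y w)
      rw [sub_add_sub_cancel] at h1
      have h2 : (y u - y v) ⬝ᵥ (y u - y v) ≤
          ∑ k, ∑ l, a k l * ((y k - y l) ⬝ᵥ (y k - y l)) := by
        have hnn : ∀ k l, 0 ≤ a k l * ((y k - y l) ⬝ᵥ (y k - y l)) :=
          fun k l => mul_nonneg (ha0 k l) (dotProduct_self_nonneg' _)
        calc (y u - y v) ⬝ᵥ (y u - y v) = a u v * ((y u - y v) ⬝ᵥ (y u - y v)) := by
              rw [ha u v huv, one_mul]
          _ ≤ ∑ l, a u l * ((y u - y l) ⬝ᵥ (y u - y l)) :=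
              Finset.single_le_sum (f := fun l => a u l * ((y u - y l) ⬝ᵥ (y u - y l)))
                (fun l _ => hnn u l) (Finset.mem_univ v)
          _ ≤ _ := Finset.single_le_sum
                (f := fun k => ∑ l, a k l * ((y k - y l) ⬝ᵥ (y k - y l)))
                (fun k _ => Finset.sum_nonneg fun l _ => hnn k l) (Finset.mem_univ u)
      have h3 := h y
      linarith
  choose C hC h using key
  obtain ⟨i₀⟩ := hG.nonempty
  refine ⟨∑ i, C i i₀, Finset.sum_nonneg fun i _ => hC i i₀, fun y => ?_⟩
  refine (sum_dev_sq_le y (y i₀)).trans ?_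
  rw [Finset.sum_mul]
  exact Finset.sum_le_sum fun i _ => h i i₀ y

end Graph

/-! ### The algebraic dissipation inequality on the graph. -/

section Coupling

variable {N p : ℕ}

/-- The usual Laplacian symmetrization: swapping `i` and `j` changes the sign of the difference.
This is where symmetric gains are needed. -/
theorem two_mul_sum_dotProduct_sub (k : Fin N → Fin N → ℝ) (hk : ∀ i j, k i j = k j i)
    (g : Fin N → Fin p → ℝ) :
    2 * ∑ i, ∑ j, k i j * (g i ⬝ᵥ (g i - g j)) =
      ∑ i, ∑ j, k i j * ((g i - g j) ⬝ᵥ (g i - g j)) := by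
  have h : ∑ i, ∑ j, k i j * (g j ⬝ᵥ (g i - g j)) = -∑ i, ∑ j, k i j * (g i ⬝ᵥ (g i - g j)) := by
    rw [Finset.sum_comm, ← Finset.sum_neg_distrib]
    refine Finset.sum_congr rfl fun i _ => ?_
    rw [← Finset.sum_neg_distrib]
    refine Finset.sum_congr rfl fun j _ => ?_
    rw [hk j i, ← neg_sub (g i) (g j), dotProduct_neg, mul_neg]
  simp only [sub_dotProduct, mul_sub, Finset.sum_sub_distrib] at h ⊢
  simp only [dotProduct_sub, mul_sub, Finset.sum_sub_distrib] at h ⊢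
  linarith

/-- The cross term of a single edge, when the coupling gain is at least `-m`. -/
theorem edge_cross_le {c m : ℝ} (hm : 0 ≤ m) (hc : -m ≤ c) (z w : Fin p → ℝ) :
    4 * (c * (z ⬝ᵥ w)) ≤ 1 / 2 * (c * (w ⬝ᵥ w)) + 8 * (c * (z ⬝ᵥ z)) +
      m * (5 / 2 * (w ⬝ᵥ w) + 10 * (z ⬝ᵥ z)) := by
  have h1 := dotProduct_self_nonneg' (w - (4 : ℝ) • z)
  have h2 := dotProduct_self_nonneg' (w + z)
  rw [dotProduct_sub_self, dotProduct_smul, smul_dotProduct, dotProduct_smul, smul_eq_mul,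
    smul_eq_mul, smul_eq_mul, dotProduct_comm w z] at h1
  rw [dotProduct_add_self, dotProduct_comm w z] at h2
  -- For `c ≥ 0` Young's inequality from `|w - 4z|² ≥ 0` would suffice; using `c + m` as the
  -- nonnegative weight instead leaves an error proportional to `m`.
  have h3 := mul_nonneg (by linarith : 0 ≤ c + m) h1
  have h4 := mul_nonneg hm h2
  nlinarith

/-- The dissipation inequality in terms of the outputs `y i = Bᵀ P η i` and `z i = Bᵀ P e i`. -/
theorem coupling_dissipation (a : Fin N → Fin N → ℝ) (ha01 : ∀ i j, a i j = 0 ∨ a i j = 1)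
    (hasymm : ∀ i j, a i j = a j i) (hdeg : ∀ i, 1 ≤ ∑ j, a i j) {CG δ μ m : ℝ} (hCG : 0 ≤ CG)
    (hδ : 0 < δ) (hm : 0 ≤ m) (c : Fin N → Fin N → ℝ)
    (hcs : ∀ i j, a i j = 1 → c i j = c j i) (hc : ∀ i j, a i j = 1 → -m ≤ c i j)
    (y g : Fin N → Fin p → ℝ)
    (hy : ∑ i, y i ⬝ᵥ y i ≤ CG * ∑ i, ∑ j, a i j * ((y i - y j) ⬝ᵥ (y i - y j)))
    (htr : ∀ i, ∑ j, (1 + δ * c i j) * a i j * ((g i - y i) ⬝ᵥ (g i - y i)) ≤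
      1 / 4 * ∑ j, a i j * ((g i - g j) ⬝ᵥ (g i - g j)) + μ) :
    ∑ i, y i ⬝ᵥ y i + ∑ i, (g i - y i) ⬝ᵥ (g i - y i)
      - 2 * ∑ i, ∑ j, c i j * a i j * (y i ⬝ᵥ (g i - g j))
      + 2 * ∑ i, ∑ j, c i j * a i j * ((g i - y i) ⬝ᵥ (g i - g j))
      + 1 / 2 * ∑ i, ∑ j, a i j * ((c i j - (4 * CG + (8 * CG + 1) / 2 + 4 / δ)) *
          ((g i - g j) ⬝ᵥ (g i - g j)))
      ≤ (8 * CG + 1 + 8 / δ) * (N * μ) + m * ((20 * N + (10 + (8 * CG + 1) * δ) * N) *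
        (∑ i, y i ⬝ᵥ y i + ∑ i, (g i - y i) ⬝ᵥ (g i - y i))) := by
  set z : Fin N → Fin p → ℝ := fun i => g i - y i with hz
  set w : Fin N → Fin N → Fin p → ℝ := fun i j => g i - g j with hw
  have hzi : ∀ i, g i - y i = z i := fun i => rfl
  have hwi : ∀ i j, g i - g j = w i j := fun i j => rfl
  simp only [hzi, hwi] at htr ⊢
  have ha0 : ∀ i j, 0 ≤ a i j := fun i j => by rcases ha01 i j with h | h <;> simp [h]
  have ha1 : ∀ i j, a i j ≤ 1 := fun i j => by rcases ha01 i j with h | h <;> simp [h]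
  have hca : ∀ i j, c i j * a i j = c j i * a j i := fun i j => by
    rcases ha01 i j with h | h
    · rw [← hasymm i j, h, mul_zero, mul_zero]
    · rw [← hasymm i j, hcs i j h]
  set W := ∑ i, ∑ j, a i j * (w i j ⬝ᵥ w i j) with hW
  set Z := ∑ i, ∑ j, a i j * (z i ⬝ᵥ z i) with hZ
  set X := ∑ i, ∑ j, a i j * (c i j * (z i ⬝ᵥ z i)) with hX
  set V := ∑ i, ∑ j, a i j * (c i j * (w i j ⬝ᵥ w i j)) with hV
  set Y := ∑ i, y i ⬝ᵥ y i with hY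
  set Z0 := ∑ i, z i ⬝ᵥ z i with hZ0
  -- Writing `y = g - z` exposes the negative term `-V` and doubles the cross term, hence the factor
  -- 4 in `hcross`.
  have hsplit : - 2 * ∑ i, ∑ j, c i j * a i j * (y i ⬝ᵥ w i j) =
      -V + 2 * ∑ i, ∑ j, c i j * a i j * (z i ⬝ᵥ w i j) := by
    have h1 := two_mul_sum_dotProduct_sub (fun i j => c i j * a i j) hca g
    have h2 : ∀ i j, c i j * a i j * (g i ⬝ᵥ (g i - g j)) =
        c i j * a i j * (y i ⬝ᵥ w i j) + c i j * a i j * (z i ⬝ᵥ w i j) := fun i j => by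
      rw [← mul_add, ← add_dotProduct]; simp [z, w]
    have h3 : V = ∑ i, ∑ j, c i j * a i j * ((g i - g j) ⬝ᵥ (g i - g j)) :=
      Finset.sum_congr rfl fun i _ => Finset.sum_congr rfl fun j _ => by
        simp only [w]; ring
    simp only [h2, Finset.sum_add_distrib] at h1
    rw [h3, ← h1]; ring
  have hcross : 4 * ∑ i, ∑ j, c i j * a i j * (z i ⬝ᵥ w i j) ≤
      1 / 2 * V + 8 * X + m * (5 / 2 * W + 10 * Z) := by
    simp only [hV, hX, hW, hZ, Finset.mul_sum, ← Finset.sum_add_distrib]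
    refine Finset.sum_le_sum fun i _ => Finset.sum_le_sum fun j _ => ?_
    rcases ha01 i j with h | h
    · simp [h]
    · have := edge_cross_le hm (hc i j h) (z i) (w i j)
      simp only [h]; linarith
  have hV2 : ∑ i, ∑ j, a i j * ((c i j - (4 * CG + (8 * CG + 1) / 2 + 4 / δ)) *
      (w i j ⬝ᵥ w i j)) = V - (4 * CG + (8 * CG + 1) / 2 + 4 / δ) * W := by
    simp only [hV, hW, Finset.mul_sum, ← Finset.sum_sub_distrib]
    exact Finset.sum_congr rfl fun i _ => Finset.sum_congr rfl fun j _ => by ring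
  -- Summed over agents, the triggering condition bounds the measurement errors by edge differences,
  -- in both the plain and the gain-weighted form.
  have htrig : Z + δ * X ≤ 1 / 4 * W + N * μ := by
    have h1 := Finset.sum_le_sum fun i (_ : i ∈ Finset.univ) => htr i
    rw [Finset.sum_add_distrib, ← Finset.mul_sum, Finset.sum_const, Finset.card_univ,
      Fintype.card_fin, nsmul_eq_mul] at h1
    refine le_trans (le_of_eq ?_) h1
    simp only [hZ, hX, Finset.mul_sum, ← Finset.sum_add_distrib]
    exact Finset.sum_congr rfl fun i _ => Finset.sum_congr rfl fun j _ => by ring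
  have hXm : -m * Z ≤ X := by
    simp only [hZ, hX, Finset.mul_sum]
    refine Finset.sum_le_sum fun i _ => Finset.sum_le_sum fun j _ => ?_
    rcases ha01 i j with h | h
    · simp [h]
    · have := mul_le_mul_of_nonneg_right (hc i j h) (dotProduct_self_nonneg' (z i))
      simp only [h]; linarith
  have hZN : Z ≤ N * Z0 := by
    have : N * Z0 = ∑ i, ∑ _j : Fin N, z i ⬝ᵥ z i := by
      simp [hZ0, Finset.mul_sum]
    rw [this]
    refine Finset.sum_le_sum fun i _ => Finset.sum_le_sum fun j _ => ?_
    exact mul_le_of_le_one_left (dotProduct_self_nonneg' _) (ha1 i j)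
  have hZ0Z : Z0 ≤ Z := by
    refine Finset.sum_le_sum fun i _ => ?_
    rw [← Finset.sum_mul]
    exact le_mul_of_one_le_left (dotProduct_self_nonneg' _) (hdeg i)
  -- The Poincaré bound on `y` must be passed to `g`, the quantity damped by the coupling; the
  -- difference is paid for with `Z`.
  have hZsymm : ∑ i, ∑ j, a i j * (z j ⬝ᵥ z j) = Z := by
    rw [Finset.sum_comm]
    exact Finset.sum_congr rfl fun i _ => Finset.sum_congr rfl fun j _ => by rw [hasymm]
  have hYW : Y ≤ CG * (2 * W + 8 * Z) := by
    refine hy.trans (mul_le_mul_of_nonneg_left ?_ hCG)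
    have : 2 * W + 8 * Z = ∑ i, ∑ j, a i j *
        (2 * (w i j ⬝ᵥ w i j) + 4 * (z i ⬝ᵥ z i) + 4 * (z j ⬝ᵥ z j)) := by
      simp only [mul_add, Finset.sum_add_distrib]
      have e1 : ∀ k : ℝ, ∀ f : Fin N → Fin N → ℝ,
          ∑ i, ∑ j, a i j * (k * f i j) = k * ∑ i, ∑ j, a i j * f i j := fun k f => by
        simp only [Finset.mul_sum]
        exact Finset.sum_congr rfl fun i _ => Finset.sum_congr rfl fun j _ => by ring
      rw [e1 2 fun i j => w i j ⬝ᵥ w i j, e1 4 fun i _ => z i ⬝ᵥ z i, e1 4 fun _ j => z j ⬝ᵥ z j,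
        hZsymm]
      ring
    rw [this]
    refine Finset.sum_le_sum fun i _ => Finset.sum_le_sum fun j _ =>
      mul_le_mul_of_nonneg_left ?_ (ha0 i j)
    have e : y i - y j = w i j - (z i - z j) := by simp only [w, z]; abel
    have h1 := dotProduct_sub_self_le (w i j) (z i - z j)
    have h2 := dotProduct_sub_self_le (z i) (z j)
    rw [e]; linarith
  have hWN : W ≤ 8 * N * (Y + Z0) := by
    have : 8 * N * (Y + Z0) = ∑ i, ∑ j, (4 * (y i ⬝ᵥ y i) + 4 * (z i ⬝ᵥ z i) +
        4 * (y j ⬝ᵥ y j) + 4 * (z j ⬝ᵥ z j)) := by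
      simp only [Finset.sum_add_distrib, Finset.sum_const, Finset.card_univ, Fintype.card_fin,
        nsmul_eq_mul, ← Finset.mul_sum]
      rw [← hY, ← hZ0]; ring
    rw [this]
    refine Finset.sum_le_sum fun i _ => Finset.sum_le_sum fun j _ => ?_
    refine (mul_le_of_le_one_left (dotProduct_self_nonneg' _) (ha1 i j)).trans ?_
    have e : w i j = (y i + z i) - (y j + z j) := by simp [w, z]
    have h1 := dotProduct_sub_self_le (y i + z i) (y j + z j)
    have h2 := dotProduct_add_self_le (y i) (z i)
    have h3 := dotProduct_add_self_le (y j) (z j)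
    rw [e]; linarith
  have hY0 : 0 ≤ Y := sum_dotProduct_self_nonneg y
  have hZ00 : 0 ≤ Z0 := sum_dotProduct_self_nonneg z
  have hX2 : X ≤ (1 / 4 * W + N * μ) / δ := by
    rw [le_div_iff₀ hδ]; linarith
  have hX3 : X ≤ (1 / δ) * (1 / 4 * W + N * μ) := by
    rw [one_div, inv_mul_eq_div]; exact hX2
  have hZ2 : Z ≤ 1 / 4 * W + N * μ + m * (δ * Z) := by nlinarith
  have hZ3 := mul_le_mul_of_nonneg_left hZ2 (by linarith : 0 ≤ 8 * CG + 1)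
  have hfin : m * (5 / 2 * W + (10 + (8 * CG + 1) * δ) * Z) ≤
      m * ((20 * N + (10 + (8 * CG + 1) * δ) * N) * (Y + Z0)) := by
    refine mul_le_mul_of_nonneg_left ?_ hm
    have hk : 0 ≤ 10 + (8 * CG + 1) * δ := by positivity
    have h1 := mul_le_mul_of_nonneg_left hZN hk
    have h2 : 0 ≤ (10 + (8 * CG + 1) * δ) * N * Y := by positivity
    nlinarith
  have hδ4 : (4 : ℝ) / δ = 4 * (1 / δ) := by ring
  have hδ8 : (8 : ℝ) / δ = 8 * (1 / δ) := by ring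
  -- The `V` terms add up to `-1 + 1/2 + 1/2 = 0`. The coefficient of `W` is `2 CG + (8 CG + 1)/4 +
  -- 2/δ`, from `Y`, from `Z` via `htrig`, and from `8 X`; it is exactly half of the subtracted
  -- constant, so `W` cancels too.
  rw [hV2, hδ4, hδ8]
  rw [hδ4] at *
  clear_value W Z X V Y Z0
  generalize 1 / δ = d at *
  nlinarith

end Coupling

/-! ### Riccati identities and dissipation of the Lyapunov function. -/

namespace Loop

variable {N n p q : ℕ} (S : Loop N n p q)

theorem a_eq_zero_or_one (i j : Fin N) : S.a i j = 0 ∨ S.a i j = 1 := by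
  unfold a; split_ifs <;> simp

theorem a_of_adj {i j : Fin N} (h : S.G.Adj i j) : S.a i j = 1 := by
  unfold a; rw [if_pos h]

theorem adj_of_a {i j : Fin N} (h : S.a i j = 1) : S.G.Adj i j := by
  by_contra h'
  unfold a at h; rw [if_neg h'] at h; exact zero_ne_one h

theorem a_symm (i j : Fin N) : S.a i j = S.a j i := by
  unfold a; rw [S.G.adj_comm]

theorem a_nonneg (i j : Fin N) : 0 ≤ S.a i j := by
  rcases S.a_eq_zero_or_one i j with h | h <;> simp [h]

theorem one_le_degree (hG : S.G.Connected) (hN : Nontrivial (Fin N)) (i : Fin N) :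
    1 ≤ ∑ j, S.a i j := by
  obtain ⟨j, hj⟩ := hG.preconnected.exists_adj_of_nontrivial i
  rw [← S.a_of_adj hj]
  exact Finset.single_le_sum (f := fun j => S.a i j) (fun j _ => S.a_nonneg i j) (Finset.mem_univ j)

/-- `P` is a positive definite solution of the Riccati equation, and `K`, `Γ` are the gains
constructed from it. -/
structure IsRiccati (P : Matrix (Fin n) (Fin n) ℝ) : Prop where
  posDef : P.PosDef
  eq : P * S.A + S.Aᵀ * P - P * S.B * S.Bᵀ * P + 1 = 0
  K_eq : S.K = -(S.Bᵀ * P)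
  Γ_eq : S.Γ = P * S.B * S.Bᵀ * P

variable {S}

theorem IsDesigned.exists_isRiccati (hS : S.IsDesigned) : ∃ P, S.IsRiccati P := by
  obtain ⟨P, h1, h2, h3, h4⟩ := hS.riccati
  exact ⟨P, h1, h2, h3, h4⟩

namespace IsRiccati

variable {P : Matrix (Fin n) (Fin n) ℝ}

theorem quad_Γ (hP : S.IsRiccati P) (v : Fin n → ℝ) :
    quad S.Γ v = ((S.Bᵀ * P) *ᵥ v) ⬝ᵥ ((S.Bᵀ * P) *ᵥ v) := by
  have h : S.Γ = (S.Bᵀ * P)ᵀ * (S.Bᵀ * P) := by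
    rw [hP.Γ_eq, Matrix.transpose_mul, hP.posDef.transpose_eq, Matrix.transpose_transpose]
    simp only [Matrix.mul_assoc]
  rw [quad, h, ← Matrix.mulVec_mulVec, Matrix.mulVec_transpose, dotProduct_comm,
    ← Matrix.dotProduct_mulVec]

theorem quad_Γ_nonneg (hP : S.IsRiccati P) (v : Fin n → ℝ) : 0 ≤ quad S.Γ v := by
  rw [hP.quad_Γ]; exact dotProduct_self_nonneg' _

theorem two_mul_dotProduct_A (hP : S.IsRiccati P) (v : Fin n → ℝ) :
    2 * (v ⬝ᵥ (P *ᵥ (S.A *ᵥ v))) = quad S.Γ v - v ⬝ᵥ v := by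
  have h : P * S.A + S.Aᵀ * P = S.Γ - 1 := by
    rw [hP.Γ_eq]; exact sub_eq_zero.1 (by rw [← hP.eq]; abel)
  have h1 := congrArg (fun X => v ⬝ᵥ (X *ᵥ v)) h
  simp only [Matrix.add_mulVec, Matrix.sub_mulVec, dotProduct_add, dotProduct_sub,
    Matrix.one_mulVec, ← Matrix.mulVec_mulVec] at h1
  have h2 : v ⬝ᵥ (S.Aᵀ *ᵥ (P *ᵥ v)) = v ⬝ᵥ (P *ᵥ (S.A *ᵥ v)) := by
    rw [dotProduct_mulVec_symm hP.posDef.transpose_eq v, Matrix.dotProduct_mulVec,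
      Matrix.vecMul_transpose]
  rw [h2] at h1
  unfold quad
  linarith

theorem dotProduct_B_K (hP : S.IsRiccati P) (v w : Fin n → ℝ) :
    v ⬝ᵥ (P *ᵥ (S.B *ᵥ (S.K *ᵥ w))) = -(((S.Bᵀ * P) *ᵥ v) ⬝ᵥ ((S.Bᵀ * P) *ᵥ w)) := by
  rw [hP.K_eq, Matrix.neg_mulVec, Matrix.mulVec_neg, Matrix.mulVec_neg, dotProduct_neg,
    dotProduct_mulVec_symm hP.posDef.transpose_eq, ← Matrix.mulVec_mulVec v,
    dotProduct_comm, Matrix.dotProduct_mulVec, ← Matrix.mulVec_transpose]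

end IsRiccati

variable (S)

/-- The relative feedback `∑ⱼ cᵢⱼ aᵢⱼ (hᵢ - hⱼ)`. -/
def feedback (c : Fin N → Fin N → ℝ) (h : Fin N → Fin n → ℝ) (i : Fin N) : Fin n → ℝ :=
  ∑ j, (c i j * S.a i j) • (h i - h j)

/-- Velocity of the observer of agent `i`, where `s` are the observation errors. -/
def observerRate (c : Fin N → Fin N → ℝ) (χ h s : Fin N → Fin n → ℝ) (i : Fin N) : Fin n → ℝ :=
  S.A *ᵥ χ i + S.B *ᵥ (S.K *ᵥ S.feedback c h i) + S.F *ᵥ (S.C *ᵥ s i)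

/-- The Lyapunov function, in terms of the observer states `χ` and the held estimates `h`. -/
def lyap (P : Matrix (Fin n) (Fin n) ℝ) (α : ℝ) (c : Fin N → Fin N → ℝ)
    (χ h : Fin N → Fin n → ℝ) : ℝ :=
  ∑ i, ∑ j, S.a i j * ((c i j - α) ^ 2 / (4 * S.κ i j)) + ∑ i, quad P (dev χ i)
    + ∑ i, quad P (h i - χ i)

/-- The rate of change of `lyap` between events. -/
def lyapRate (P : Matrix (Fin n) (Fin n) ℝ) (α : ℝ) (c : Fin N → Fin N → ℝ)
    (χ h s : Fin N → Fin n → ℝ) : ℝ :=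
  ∑ i, ∑ j, S.a i j * ((c i j - α) / 2 * (-S.ϱ i j * c i j + quad S.Γ (h i - h j)))
    + ∑ i, 2 * (dev χ i ⬝ᵥ (P *ᵥ dev (S.observerRate c χ h s) i))
    + ∑ i, 2 * ((h i - χ i) ⬝ᵥ (P *ᵥ (S.A *ᵥ h i - S.observerRate c χ h s i)))

variable {S}

theorem IsRiccati.sum_dev_rate {P : Matrix (Fin n) (Fin n) ℝ} (hP : S.IsRiccati P)
    (c : Fin N → Fin N → ℝ) (χ h s : Fin N → Fin n → ℝ) :
    ∑ i, 2 * (dev χ i ⬝ᵥ (P *ᵥ dev (S.observerRate c χ h s) i)) =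
      ∑ i, (quad S.Γ (dev χ i) - dev χ i ⬝ᵥ dev χ i
        - 2 * (((S.Bᵀ * P) *ᵥ dev χ i) ⬝ᵥ ((S.Bᵀ * P) *ᵥ S.feedback c h i))
        + 2 * (dev χ i ⬝ᵥ (P *ᵥ (S.F *ᵥ (S.C *ᵥ s i))))) := by
  have h1 : ∑ i, dev χ i ⬝ᵥ (P *ᵥ dev (S.observerRate c χ h s) i) =
      ∑ i, dev χ i ⬝ᵥ (P *ᵥ S.observerRate c χ h s i) := by
    rw [← sum_dev_dotProduct_sub χ (fun i => P *ᵥ S.observerRate c χ h s i)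
      ((1 / (N : ℝ)) • ∑ j, P *ᵥ S.observerRate c χ h s j)]
    exact Finset.sum_congr rfl fun i _ => by rw [mulVec_dev]; rfl
  have h2 : ∑ i, dev χ i ⬝ᵥ (P *ᵥ (S.A *ᵥ χ i)) = ∑ i, dev χ i ⬝ᵥ (P *ᵥ (S.A *ᵥ dev χ i)) := by
    rw [← sum_dev_dotProduct_sub χ (fun i => P *ᵥ (S.A *ᵥ χ i))
      ((1 / (N : ℝ)) • ∑ j, P *ᵥ (S.A *ᵥ χ j))]
    exact Finset.sum_congr rfl fun i _ => by rw [mulVec_dev, mulVec_dev]; rfl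
  have h3 : ∀ i, dev χ i ⬝ᵥ (P *ᵥ S.observerRate c χ h s i) = dev χ i ⬝ᵥ (P *ᵥ (S.A *ᵥ χ i))
      + (-(((S.Bᵀ * P) *ᵥ dev χ i) ⬝ᵥ ((S.Bᵀ * P) *ᵥ S.feedback c h i))
        + dev χ i ⬝ᵥ (P *ᵥ (S.F *ᵥ (S.C *ᵥ s i)))) := fun i => by
    rw [observerRate, Matrix.mulVec_add, Matrix.mulVec_add, dotProduct_add, dotProduct_add,
      hP.dotProduct_B_K, add_assoc]
  rw [← Finset.mul_sum, h1]
  simp only [h3]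
  rw [Finset.sum_add_distrib, h2, ← Finset.sum_add_distrib, Finset.mul_sum]
  refine Finset.sum_congr rfl fun i _ => ?_
  have := hP.two_mul_dotProduct_A (dev χ i)
  linarith

/-- The held estimate follows the same drift `A` as the observer, so the absolute state, which
nothing bounds, drops out of the error velocity. -/
theorem mulVec_sub_observerRate (c : Fin N → Fin N → ℝ) (χ h s : Fin N → Fin n → ℝ) (i : Fin N) :
    S.A *ᵥ h i - S.observerRate c χ h s i = S.A *ᵥ (h i - χ i)
      - S.B *ᵥ (S.K *ᵥ S.feedback c h i) - S.F *ᵥ (S.C *ᵥ s i) := by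
  rw [observerRate, Matrix.mulVec_sub]; abel

theorem IsRiccati.error_rate {P : Matrix (Fin n) (Fin n) ℝ} (hP : S.IsRiccati P)
    (c : Fin N → Fin N → ℝ) (χ h s : Fin N → Fin n → ℝ) (i : Fin N) :
    2 * ((h i - χ i) ⬝ᵥ (P *ᵥ (S.A *ᵥ h i - S.observerRate c χ h s i))) =
      quad S.Γ (h i - χ i) - (h i - χ i) ⬝ᵥ (h i - χ i)
        + 2 * (((S.Bᵀ * P) *ᵥ (h i - χ i)) ⬝ᵥ ((S.Bᵀ * P) *ᵥ S.feedback c h i))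
        - 2 * ((h i - χ i) ⬝ᵥ (P *ᵥ (S.F *ᵥ (S.C *ᵥ s i)))) := by
  have h2 := hP.two_mul_dotProduct_A (h i - χ i)
  rw [mulVec_sub_observerRate, Matrix.mulVec_sub, Matrix.mulVec_sub, dotProduct_sub,
    dotProduct_sub, hP.dotProduct_B_K]
  linarith

theorem mulVec_feedback_dotProduct {k : ℕ} (X : Matrix (Fin k) (Fin n) ℝ) (v : Fin k → ℝ)
    (c : Fin N → Fin N → ℝ) (h : Fin N → Fin n → ℝ) (i : Fin N) :
    v ⬝ᵥ (X *ᵥ S.feedback c h i) =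
      ∑ j, c i j * S.a i j * (v ⬝ᵥ (X *ᵥ (h i - h j))) := by
  simp only [feedback, Matrix.mulVec_sum, Matrix.mulVec_smul, dotProduct_sum, dotProduct_smul,
    smul_eq_mul]

/-- Dissipation of the Lyapunov function, uniformly in all states in which no triggering condition
is violated and all coupling gains are at least `-m`. -/
theorem IsDesigned.exists_lyapRate_le (hS : S.IsDesigned) (hG : S.G.Connected)
    (hN : Nontrivial (Fin N)) {P : Matrix (Fin n) (Fin n) ℝ} (hP : S.IsRiccati P) :
    ∃ α C₁ C₂ C₃ : ℝ, 0 ≤ C₁ ∧ 0 ≤ C₂ ∧ 0 ≤ C₃ ∧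
      ∀ (t m : ℝ) (c : Fin N → Fin N → ℝ) (χ h s : Fin N → Fin n → ℝ), 0 ≤ t → 0 ≤ m →
        (∀ i j, S.G.Adj i j → c i j = c j i) → (∀ i j, S.G.Adj i j → -m ≤ c i j) →
        (∀ i, S.trigger t c i (χ i) h < 0) →
        S.lyapRate P α c χ h s ≤
          -(1 / 4 * ∑ i, ∑ j, S.a i j * (S.ϱ i j * (c i j - α) ^ 2))
          - 1 / 2 * (∑ i, dev χ i ⬝ᵥ dev χ i + ∑ i, (h i - χ i) ⬝ᵥ (h i - χ i))
          + m * (C₁ * (∑ i, dev χ i ⬝ᵥ dev χ i + ∑ i, (h i - χ i) ⬝ᵥ (h i - χ i)))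
          + C₂ + C₃ * ∑ i, s i ⬝ᵥ s i := by
  obtain ⟨CG, hCG, hpoin⟩ := exists_sum_dev_le (p := p) S.G hG S.a (fun i j => S.a_of_adj) S.a_nonneg
  have hδ := hS.δ_pos
  have hμ := hS.μ_pos
  set L := S.Bᵀ * P with hL
  -- The reference gain of the Lyapunov function is the constant of `coupling_dissipation`; it
  -- appears only in the analysis, not in the protocol.
  set α := 4 * CG + (8 * CG + 1) / 2 + 4 / S.δ with hα
  have hϱ0 : ∀ i j, 0 ≤ S.a i j * S.ϱ i j := fun i j => by
    rcases S.a_eq_zero_or_one i j with h | h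
    · simp [h]
    · rw [h, one_mul]; exact (hS.ϱ_pos i j (S.adj_of_a h)).le
  set D := 1 / 4 * ∑ i, ∑ j, S.a i j * (S.ϱ i j * α ^ 2) with hD
  have hD0 : 0 ≤ D := by
    refine mul_nonneg (by norm_num) (Finset.sum_nonneg fun i _ => Finset.sum_nonneg fun j _ => ?_)
    rw [← mul_assoc]
    exact mul_nonneg (hϱ0 i j) (sq_nonneg _)
  set k := 20 * (N : ℝ) + (10 + (8 * CG + 1) * S.δ) * N with hk
  have hk0 : 0 ≤ k := by positivity
  refine ⟨α, k * frobSq L, (8 * CG + 1 + 8 / S.δ) * (N * S.μ) + D,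
    4 * frobSq (P * S.F * S.C), mul_nonneg hk0 (frobSq_nonneg _), by positivity,
    mul_nonneg (by norm_num) (frobSq_nonneg _), ?_⟩
  intro t m c χ h s ht hm hcs hc htr
  set y : Fin N → Fin p → ℝ := fun i => L *ᵥ dev χ i with hy
  -- The held output up to a common shift: the mean cancels in `g i - g j`, and `g - y` is the
  -- measurement error output.
  set g : Fin N → Fin p → ℝ := fun i => L *ᵥ (dev χ i + (h i - χ i)) with hg
  have hgy : ∀ i, g i - y i = L *ᵥ (h i - χ i) := fun i => by
    rw [hg, hy, ← Matrix.mulVec_sub, add_sub_cancel_left]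
  have hgg : ∀ i j, g i - g j = L *ᵥ (h i - h j) := fun i j => by
    have : dev χ i + (h i - χ i) - (dev χ j + (h j - χ j)) = h i - h j := by
      have := dev_sub_dev χ i j
      rw [sub_eq_iff_eq_add] at this
      rw [this]; abel
    rw [hg, ← Matrix.mulVec_sub, this]
  have hΓg : ∀ i j, quad S.Γ (h i - h j) = (g i - g j) ⬝ᵥ (g i - g j) := fun i j => by
    rw [hgg, hP.quad_Γ]
  have hΓy : ∀ i, quad S.Γ (dev χ i) = y i ⬝ᵥ y i := fun i => hP.quad_Γ _
  have hΓe : ∀ i, quad S.Γ (h i - χ i) = (g i - y i) ⬝ᵥ (g i - y i) := fun i => by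
    rw [hgy, hP.quad_Γ]
  have hcore := coupling_dissipation S.a S.a_eq_zero_or_one S.a_symm (S.one_le_degree hG hN)
    (μ := S.μ) hCG hδ hm c (fun i j hij => hcs i j (S.adj_of_a hij))
    (fun i j hij => hc i j (S.adj_of_a hij)) y g ?_ ?_
  · have hE := hP.sum_dev_rate c χ h s
    -- Young's inequality spends half of the `-|·|²` supplied by the Riccati equation on the
    -- observation error; the other half survives as decay.
    have hdrift : ∀ i, 2 * (dev χ i ⬝ᵥ (P *ᵥ (S.F *ᵥ (S.C *ᵥ s i))))
        - 2 * ((h i - χ i) ⬝ᵥ (P *ᵥ (S.F *ᵥ (S.C *ᵥ s i)))) ≤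
        1 / 2 * (dev χ i ⬝ᵥ dev χ i) + 1 / 2 * ((h i - χ i) ⬝ᵥ (h i - χ i)) +
          4 * frobSq (P * S.F * S.C) * (s i ⬝ᵥ s i) := fun i => by
      have e : P *ᵥ (S.F *ᵥ (S.C *ᵥ s i)) = (P * S.F * S.C) *ᵥ s i := by
        simp only [Matrix.mulVec_mulVec, Matrix.mul_assoc]
      rw [e]
      have h1 := mulVec_dotProduct_self_le (P * S.F * S.C) (s i)
      set f := (P * S.F * S.C) *ᵥ s i
      have h2 := dotProduct_self_nonneg' (dev χ i - (2 : ℝ) • f)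
      have h3 := dotProduct_self_nonneg' ((h i - χ i) + (2 : ℝ) • f)
      rw [dotProduct_sub_self, dotProduct_smul, smul_dotProduct, dotProduct_smul] at h2
      rw [dotProduct_add_self, dotProduct_smul, smul_dotProduct, dotProduct_smul] at h3
      simp only [smul_eq_mul] at h2 h3
      linarith
    have hsumdrift := Finset.sum_le_sum fun i (_ : i ∈ Finset.univ) => hdrift i
    -- Uses `2 (c - α) c = (c - α)² + c² - α²`: the leakage yields decay towards `α` at the constant
    -- cost `D`.
    have hadapt : ∑ i, ∑ j, S.a i j * ((c i j - α) / 2 * (-S.ϱ i j * c i j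
        + quad S.Γ (h i - h j))) ≤
        1 / 2 * ∑ i, ∑ j, S.a i j * ((c i j - α) * ((g i - g j) ⬝ᵥ (g i - g j)))
        - 1 / 4 * ∑ i, ∑ j, S.a i j * (S.ϱ i j * (c i j - α) ^ 2) + D := by
      simp only [hD, Finset.mul_sum, ← Finset.sum_sub_distrib, ← Finset.sum_add_distrib]
      refine Finset.sum_le_sum fun i _ => Finset.sum_le_sum fun j _ => ?_
      rw [hΓg]
      have := mul_nonneg (hϱ0 i j) (sq_nonneg (c i j))
      nlinarith
    have hylin : ∑ i, y i ⬝ᵥ y i + ∑ i, (g i - y i) ⬝ᵥ (g i - y i) ≤ frobSq L *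
        (∑ i, dev χ i ⬝ᵥ dev χ i + ∑ i, (h i - χ i) ⬝ᵥ (h i - χ i)) := by
      rw [mul_add, Finset.mul_sum, Finset.mul_sum]
      refine add_le_add (Finset.sum_le_sum fun i _ => mulVec_dotProduct_self_le _ _)
        (Finset.sum_le_sum fun i _ => ?_)
      rw [hgy]
      exact mulVec_dotProduct_self_le _ _
    have hmk := mul_le_mul_of_nonneg_left (mul_le_mul_of_nonneg_left hylin hk0) hm
    have hF1 : ∀ i, (L *ᵥ dev χ i) ⬝ᵥ (L *ᵥ S.feedback c h i) =
        ∑ j, c i j * S.a i j * (y i ⬝ᵥ (g i - g j)) := fun i => by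
      rw [mulVec_feedback_dotProduct]
      simp only [hgg, hy]
    have hF2 : ∀ i, (L *ᵥ (h i - χ i)) ⬝ᵥ (L *ᵥ S.feedback c h i) =
        ∑ j, c i j * S.a i j * ((g i - y i) ⬝ᵥ (g i - g j)) := fun i => by
      rw [mulVec_feedback_dotProduct]
      simp only [hgg, hgy]
    rw [lyapRate, hE]
    simp only [hP.error_rate, ← hL, hF1, hF2, hΓy, hΓe]
    simp only [Finset.sum_add_distrib, Finset.sum_sub_distrib, ← Finset.mul_sum] at hsumdrift hcore hadapt hmk ⊢
    linarith
  · have h1 := hpoin fun i => L *ᵥ χ i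
    have e1 : ∀ i, dev (fun i => L *ᵥ χ i) i = y i := fun i => (mulVec_dev L χ i).symm
    have e2 : ∀ i j, L *ᵥ χ i - L *ᵥ χ j = y i - y j := fun i j => by
      rw [hy, ← Matrix.mulVec_sub, ← Matrix.mulVec_sub, dev_sub_dev]
    simpa only [e1, e2] using h1
  · intro i
    have h1 := htr i
    have h2 : S.μ * Real.exp (-S.ν * t) ≤ S.μ := by
      refine mul_le_of_le_one_right hμ.le (Real.exp_le_one_iff.2 ?_)
      have := mul_nonneg hS.ν_pos.le ht
      linarith
    simp only [trigger, hΓg, hΓe] at h1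
    linarith

end Loop

/-! ### Regularity and elementary estimates along executions. -/

namespace Run

variable {N n p q : ℕ} {S : Loop N n p q} {r : Run N n}

theorem mem_dom_of_le {s t : ℝ} (ht : t ∈ r.dom) (hs : 0 ≤ s) (hst : s ≤ t) : s ∈ r.dom :=
  ⟨hs, lt_of_le_of_lt (EReal.coe_le_coe_iff.2 hst) ht.2⟩

theorem Icc_subset_dom {s t : ℝ} (hs : s ∈ r.dom) (ht : t ∈ r.dom) : Icc s t ⊆ r.dom :=
  fun _ hu => mem_dom_of_le ht (hs.1.trans hu.1) hu.2

theorem exists_gt_mem_dom {t : ℝ} (ht : t ∈ r.dom) : ∃ u ∈ r.dom, t < u := by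
  obtain ⟨u, hu1, hu2⟩ := EReal.lt_iff_exists_real_btwn.1 ht.2
  have := EReal.coe_lt_coe_iff.1 hu1
  exact ⟨u, ⟨ht.1.trans this.le, hu2⟩, this⟩

namespace IsExecution

theorem zero_mem_dom (hr : r.IsExecution S) : (0 : ℝ) ∈ r.dom :=
  ⟨le_rfl, by simpa using hr.T_pos⟩

/-- Events are isolated. -/
theorem exists_isolated (hr : r.IsExecution S) (i : Fin N) {t : ℝ} (ht : t ∈ r.dom) :
    ∃ ε > 0, ∀ e ∈ r.E i, |e - t| < ε → e = t := by
  -- Local finiteness is applied at a time beyond `t`, to isolate `t` from later events as well.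
  obtain ⟨u, hu, htu⟩ := exists_gt_mem_dom ht
  have hfin : ((r.E i ∩ Iic u) \ {t}).Finite := (hr.E_locFin i u hu).subset sdiff_subset
  obtain ⟨ε, hε, hball⟩ := Metric.mem_nhds_iff.1
    (hfin.isClosed.isOpen_compl.mem_nhds (show t ∈ ((r.E i ∩ Iic u) \ {t})ᶜ by simp))
  refine ⟨min ε (u - t), lt_min hε (sub_pos.2 htu), fun e he hd => ?_⟩
  by_contra hne
  have h1 : e ∈ Metric.ball t ε := by
    rw [Metric.mem_ball, Real.dist_eq]; exact hd.trans_le (min_le_left _ _)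
  refine hball h1 ⟨⟨he, ?_⟩, hne⟩
  have := (abs_lt.1 (hd.trans_le (min_le_right _ _))).2
  simp only [mem_Iic]; linarith

theorem sSup_mem_Iic (hr : r.IsExecution S) (i : Fin N) {t : ℝ} (ht : t ∈ r.dom) :
    sSup (r.E i ∩ Iic t) ∈ r.E i ∩ Iic t :=
  Set.Nonempty.csSup_mem ⟨0, hr.zero_mem i, ht.1⟩ (hr.E_locFin i t ht)

theorem sSup_mem_Iio (hr : r.IsExecution S) (i : Fin N) {t : ℝ} (ht : t ∈ r.dom) (h0 : 0 < t) :
    sSup (r.E i ∩ Iio t) ∈ r.E i ∩ Iio t :=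
  Set.Nonempty.csSup_mem ⟨0, hr.zero_mem i, h0⟩ ((hr.E_locFin i t ht).subset
    (inter_subset_inter_right _ Iio_subset_Iic_self))

theorem held_of_event (hr : r.IsExecution S) {i : Fin N} {t : ℝ} (ht : t ∈ r.E i) :
    r.held S t i = r.χ t i := by
  have h : sSup (r.E i ∩ Iic t) = t := by
    refine le_antisymm (hr.sSup_mem_Iic i (hr.E_sub i ht)).2 ?_
    exact le_csSup ⟨t, fun x hx => hx.2⟩ ⟨ht, self_mem_Iic⟩
  rw [held, h, Loop.hold, sub_self, zero_smul, NormedSpace.exp_zero, Matrix.one_mulVec]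

theorem hasDerivWithinAt_held (hr : r.IsExecution S) (i : Fin N) {t : ℝ} (ht : t ∈ r.dom) :
    HasDerivWithinAt (fun s => r.held S s i) (S.A *ᵥ r.held S t i) (Ici t) t := by
  obtain ⟨ε, hε, hiso⟩ := hr.exists_isolated i ht
  have h := (hasDerivAt_exp_sub_smul_mulVec S.A (sSup (r.E i ∩ Iic t)) t
    (r.χ (sSup (r.E i ∩ Iic t)) i)).hasDerivWithinAt (s := Ici t)
  refine h.congr_of_eventuallyEq ?_ rfl
  filter_upwards [Ico_mem_nhdsGE (show t < t + ε by linarith)] with s hs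
  have : r.E i ∩ Iic s = r.E i ∩ Iic t := by
    ext e
    refine ⟨fun he => ⟨he.1, ?_⟩, fun he => ⟨he.1, le_trans he.2 hs.1⟩⟩
    by_contra hlt
    simp only [mem_Iic, not_le] at hlt
    have h1 : e ≤ s := he.2
    have := hiso e he.1 (by rw [abs_of_pos (sub_pos.2 hlt)]; linarith [hs.2])
    exact hlt.ne' this
  rw [held, this]
  rfl

theorem continuousAt_held (hr : r.IsExecution S) (i : Fin N) {t : ℝ} (ht : t ∈ r.dom)
    (hE : t ∉ r.E i) : ContinuousAt (fun s => r.held S s i) t := by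
  obtain ⟨ε, hε, hiso⟩ := hr.exists_isolated i ht
  have h := (hasDerivAt_exp_sub_smul_mulVec S.A (sSup (r.E i ∩ Iic t)) t
    (r.χ (sSup (r.E i ∩ Iic t)) i)).continuousAt
  refine h.congr ?_
  filter_upwards [Metric.ball_mem_nhds t hε] with s hs
  rw [Metric.mem_ball, Real.dist_eq, abs_lt] at hs
  have : r.E i ∩ Iic s = r.E i ∩ Iic t := by
    ext e
    refine ⟨fun he => ⟨he.1, ?_⟩, fun he => ⟨he.1, ?_⟩⟩ <;> by_contra hlt <;>
      simp only [mem_Iic, not_le] at hlt <;> have h1 := he.2 <;> simp only [mem_Iic] at h1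
    · have := hiso e he.1 (by rw [abs_lt]; constructor <;> linarith)
      exact hE (this ▸ he.1)
    · have := hiso e he.1 (by rw [abs_lt]; constructor <;> linarith)
      exact hE (this ▸ he.1)
  rw [held, this]
  rfl

/-- The measurement error can only jump to zero. -/
theorem lowerSemicontinuousOn_quad_error (hr : r.IsExecution S) {P : Matrix (Fin n) (Fin n) ℝ}
    (hP : P.PosDef) (i : Fin N) :
    LowerSemicontinuousOn (fun t => quad P (r.held S t i - r.χ t i)) r.dom := by
  intro t ht
  by_cases hE : t ∈ r.E i
  -- At an event the value is zero, the minimum of a nonnegative function, so semicontinuity is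
  -- automatic.
  · intro y hy
    simp only [hr.held_of_event hE, sub_self] at hy
    have hy0 : y < 0 := by simpa [quad] using hy
    exact Eventually.of_forall fun s => hy0.trans_le (quad_nonneg_of_posDef hP _)
  · have h1 := (hr.continuousAt_held i ht hE).continuousWithinAt (s := r.dom)
    have h2 := continuousWithinAt_pi.1 (hr.χ_cont t ht) i
    exact ((continuous_quad P).continuousAt.comp_continuousWithinAt (h1.sub h2)).lowerSemicontinuousWithinAt

theorem c_continuousOn (hr : r.IsExecution S) (i j : Fin N) :
    ContinuousOn (fun t => r.c t i j) r.dom :=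
  continuousOn_pi.1 (continuousOn_pi.1 hr.c_cont i) j

theorem χ_continuousOn (hr : r.IsExecution S) (i : Fin N) : ContinuousOn (fun t => r.χ t i) r.dom :=
  continuousOn_pi.1 hr.χ_cont i

theorem hasDerivWithinAt_χ (hr : r.IsExecution S) {t : ℝ} (ht : t ∈ r.dom) (i : Fin N) :
    HasDerivWithinAt (fun s => r.χ s i)
      (S.observerRate (r.c t) (r.χ t) (r.held S t) (fun i => r.χ t i - r.x t i) i) (Ici t) t := by
  have h := hr.χ_ode t ht i
  rw [← Matrix.mulVec_sub] at h
  exact h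

theorem dev_continuousOn (hr : r.IsExecution S) (i : Fin N) :
    ContinuousOn (fun t => dev (r.χ t) i) r.dom :=
  (hr.χ_continuousOn i).sub
    ((continuousOn_finsetSum _ fun j _ => hr.χ_continuousOn j).fun_const_smul _)

theorem hasDerivWithinAt_dev (hr : r.IsExecution S) {t : ℝ} (ht : t ∈ r.dom) (i : Fin N) :
    HasDerivWithinAt (fun s => dev (r.χ s) i)
      (dev (S.observerRate (r.c t) (r.χ t) (r.held S t) (fun i => r.χ t i - r.x t i)) i)
      (Ici t) t :=
  (hr.hasDerivWithinAt_χ ht i).sub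
    ((HasDerivWithinAt.fun_sum fun j _ => hr.hasDerivWithinAt_χ ht j).fun_const_smul _)

theorem lyap_lowerSemicontinuousOn (hr : r.IsExecution S) {P : Matrix (Fin n) (Fin n) ℝ}
    (hP : P.PosDef) (α : ℝ) :
    LowerSemicontinuousOn (fun t => S.lyap P α (r.c t) (r.χ t) (r.held S t)) r.dom := by
  refine LowerSemicontinuousOn.add (ContinuousOn.lowerSemicontinuousOn ?_)
    (lowerSemicontinuousOn_sum fun i _ => hr.lowerSemicontinuousOn_quad_error hP i)
  refine ContinuousOn.add ?_ ?_
  · exact continuousOn_finsetSum _ fun i _ => continuousOn_finsetSum _ fun j _ =>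
      ((((hr.c_continuousOn i j).sub continuousOn_const).pow 2).div_const _).const_mul _
  · exact continuousOn_finsetSum _ fun i _ =>
      (continuous_quad P).comp_continuousOn (hr.dev_continuousOn i)

theorem hasDerivWithinAt_lyap (hr : r.IsExecution S) (hS : S.IsDesigned)
    {P : Matrix (Fin n) (Fin n) ℝ} (hP : P.PosDef) (α : ℝ) {t : ℝ} (ht : t ∈ r.dom) :
    HasDerivWithinAt (fun t => S.lyap P α (r.c t) (r.χ t) (r.held S t))
      (S.lyapRate P α (r.c t) (r.χ t) (r.held S t) (fun i => r.χ t i - r.x t i)) (Ici t) t := by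
  refine ((HasDerivWithinAt.fun_sum fun i _ => HasDerivWithinAt.fun_sum fun j _ => ?_).add
    (HasDerivWithinAt.fun_sum fun i _ => (hr.hasDerivWithinAt_dev ht i).quad hP.transpose_eq)).add
    (HasDerivWithinAt.fun_sum fun i _ =>
      ((hr.hasDerivWithinAt_held i ht).sub (hr.hasDerivWithinAt_χ ht i)).quad hP.transpose_eq)
  have h := ((((hr.c_ode t ht i j).sub_const α).fun_pow 2).div_const (4 * S.κ i j)).const_mul
    (S.a i j)
  refine h.congr_deriv ?_
  rcases S.a_eq_zero_or_one i j with ha | ha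
  · simp [ha]
  · have hκ := (hS.κ_pos i j (S.adj_of_a ha)).ne'
    simp only [ha]
    field_simp
    ring

theorem obs_continuousOn (hr : r.IsExecution S) (i : Fin N) :
    ContinuousOn (fun t => r.χ t i - r.x t i) r.dom :=
  (hr.χ_continuousOn i).sub (continuousOn_pi.1 hr.x_cont i)

/-- The input enters plant and observer identically and cancels, so events leave no trace in this
error. -/
theorem observation_error_eq (hr : r.IsExecution S) (i : Fin N) {t₀ t : ℝ} (ht₀ : t₀ ∈ r.dom)
    (ht : t ∈ r.dom) (hle : t₀ ≤ t) :
    r.χ t i - r.x t i =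
      NormedSpace.exp ((t - t₀) • (S.A + S.F * S.C)) *ᵥ (r.χ t₀ i - r.x t₀ i) := by
  refine eq_exp_mulVec_of_deriv_right (S.A + S.F * S.C) (v := fun t => r.χ t i - r.x t i)
    ((hr.obs_continuousOn i).mono (Icc_subset_dom ht₀ ht)) (fun s hs => ?_) hle
  have hsd : s ∈ r.dom := Icc_subset_dom ht₀ ht ⟨hs.1, hs.2.le⟩
  refine ((hr.χ_ode s hsd i).sub (hr.x_ode s hsd i)).congr_deriv ?_
  rw [Matrix.add_mulVec, ← Matrix.mulVec_mulVec, Matrix.mulVec_sub, Matrix.mulVec_sub,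
    Matrix.mulVec_sub, Matrix.mulVec_sub]
  abel

theorem sum_observation_error_le (hr : r.IsExecution S) {t₀ t : ℝ} (ht₀ : t₀ ∈ r.dom)
    (ht : t ∈ r.dom) (hle : t₀ ≤ t) :
    ∑ i, (r.χ t i - r.x t i) ⬝ᵥ (r.χ t i - r.x t i) ≤
      frobSq (NormedSpace.exp ((t - t₀) • (S.A + S.F * S.C))) *
        ∑ i, (r.χ t₀ i - r.x t₀ i) ⬝ᵥ (r.χ t₀ i - r.x t₀ i) := by
  rw [Finset.mul_sum]
  refine Finset.sum_le_sum fun i _ => ?_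
  rw [hr.observation_error_eq i ht₀ ht hle]
  exact mulVec_dotProduct_self_le _ _

theorem quad_sub_comm (Γ : Matrix (Fin n) (Fin n) ℝ) (v w : Fin n → ℝ) :
    quad Γ (v - w) = quad Γ (w - v) := by
  rw [← neg_sub w v, quad, Matrix.mulVec_neg, neg_dotProduct_neg, quad]

/-- The two gains of an edge have the same forcing, so their difference times `e^{κϱt}` is constant,
and it starts at zero. -/
theorem gain_symm (hr : r.IsExecution S) (hS : S.IsDesigned) {i j : Fin N} (hij : S.G.Adj i j)
    {t : ℝ} (ht : t ∈ r.dom) : r.c t i j = r.c t j i := by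
  set k := S.κ i j * S.ϱ i j with hk
  have hd : ∀ s ∈ Ico 0 t, HasDerivWithinAt
      (fun s => (r.c s i j - r.c s j i) * Real.exp (k * s)) 0 (Ici s) s := by
    intro s hs
    have hsd := mem_dom_of_le ht hs.1 hs.2.le
    have he : HasDerivWithinAt (fun s => Real.exp (k * s)) (Real.exp (k * s) * k) (Ici s) s := by
      simpa using (((hasDerivAt_id s).const_mul k).exp).hasDerivWithinAt
    refine (((hr.c_ode s hsd i j).sub (hr.c_ode s hsd j i)).mul he).congr_deriv ?_
    rw [S.a_of_adj hij, S.a_of_adj hij.symm, ← hS.κ_symm i j hij, ← hS.ϱ_symm i j hij,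
      quad_sub_comm S.Γ (r.held S s j), hk]
    simp only [Pi.sub_apply]
    ring
  have hc : ContinuousOn (fun s => (r.c s i j - r.c s j i) * Real.exp (k * s)) (Icc 0 t) := by
    refine ContinuousOn.mul ?_ (by fun_prop)
    exact (((hr.c_continuousOn i j).sub (hr.c_continuousOn j i))).mono
      (Icc_subset_dom hr.zero_mem_dom ht)
  have h := constant_of_has_deriv_right_zero hc hd t ⟨ht.1, le_rfl⟩
  simp only [hr.c_symm i j hij, sub_self, zero_mul] at h
  exact sub_eq_zero.1 ((mul_eq_zero.1 h).resolve_right (Real.exp_ne_zero _))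

/-- The forcing `quad S.Γ` is nonnegative, so a negative gain relaxes towards zero at least at the
leakage rate. -/
theorem neg_gain_le (hr : r.IsExecution S) (hS : S.IsDesigned) {P : Matrix (Fin n) (Fin n) ℝ}
    (hP : S.IsRiccati P) {i j : Fin N} (hij : S.G.Adj i j)
    {t₀ t : ℝ} (ht₀ : t₀ ∈ r.dom) (ht : t ∈ r.dom) (hle : t₀ ≤ t) :
    -r.c t i j ≤ -r.c t₀ i j * Real.exp (-(S.κ i j * S.ϱ i j) * (t - t₀)) := by
  have hκ := hS.κ_pos i j hij
  have hϱ := hS.ϱ_pos i j hij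
  have h := le_exp_of_deriv_right_le (f := fun s => -r.c s i j)
    (f' := fun s => -(S.κ i j * S.a i j *
      (-S.ϱ i j * r.c s i j + quad S.Γ (r.held S s i - r.held S s j)))) (C := 0)
    (mul_pos hκ hϱ).ne' hle
    (((hr.c_continuousOn i j).mono (Icc_subset_dom ht₀ ht)).neg.lowerSemicontinuousOn)
    (fun s hs => (hr.c_ode s (Icc_subset_dom ht₀ ht ⟨hs.1, hs.2.le⟩) i j).neg)
    (fun s hs => ?_)
  · simpa using h
  · rw [S.a_of_adj hij]
    have := mul_nonneg hκ.le (hP.quad_Γ_nonneg (r.held S s i - r.held S s j))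
    linarith

end IsExecution

end Run

/-! ### The Lyapunov function against the size of the state. -/

namespace Loop

variable {N n p q : ℕ} {S : Loop N n p q}

theorem IsDesigned.gain_term_nonneg (hS : S.IsDesigned) (α : ℝ) (c : Fin N → Fin N → ℝ)
    (i j : Fin N) : 0 ≤ S.a i j * ((c i j - α) ^ 2 / (4 * S.κ i j)) := by
  rcases S.a_eq_zero_or_one i j with h | h
  · simp [h]
  · have := hS.κ_pos i j (S.adj_of_a h)
    rw [h]; positivity

theorem IsDesigned.gain_sum_nonneg (hS : S.IsDesigned) (α : ℝ) (c : Fin N → Fin N → ℝ) :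
    0 ≤ ∑ i, ∑ j, S.a i j * ((c i j - α) ^ 2 / (4 * S.κ i j)) :=
  Finset.sum_nonneg fun i _ => Finset.sum_nonneg fun j _ => hS.gain_term_nonneg α c i j

theorem IsDesigned.lyap_nonneg (hS : S.IsDesigned) {P : Matrix (Fin n) (Fin n) ℝ} (hP : P.PosDef)
    (α : ℝ) (c : Fin N → Fin N → ℝ) (χ h : Fin N → Fin n → ℝ) : 0 ≤ S.lyap P α c χ h :=
  add_nonneg (add_nonneg (hS.gain_sum_nonneg α c)
    (Finset.sum_nonneg fun _ _ => quad_nonneg_of_posDef hP _))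
    (Finset.sum_nonneg fun _ _ => quad_nonneg_of_posDef hP _)

theorem IsDesigned.sq_le_lyap (hS : S.IsDesigned) {P : Matrix (Fin n) (Fin n) ℝ} {C : ℝ}
    (hC : 0 < C) (hCP : ∀ v, v ⬝ᵥ v ≤ C * quad P v)
    (α : ℝ) (c : Fin N → Fin N → ℝ) (χ h : Fin N → Fin n → ℝ) :
    ∑ i, dev χ i ⬝ᵥ dev χ i + ∑ i, (h i - χ i) ⬝ᵥ (h i - χ i) ≤ C * S.lyap P α c χ h := by
  have h1 := mul_nonneg hC.le (hS.gain_sum_nonneg α c)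
  have h2 := Finset.sum_le_sum fun i (_ : i ∈ Finset.univ) => hCP (dev χ i)
  have h3 := Finset.sum_le_sum fun i (_ : i ∈ Finset.univ) => hCP (h i - χ i)
  rw [← Finset.mul_sum] at h2 h3
  rw [lyap]
  linarith

theorem IsDesigned.gain_sq_le_lyap (hS : S.IsDesigned) {P : Matrix (Fin n) (Fin n) ℝ}
    (hP : P.PosDef) (α : ℝ) (c : Fin N → Fin N → ℝ) (χ h : Fin N → Fin n → ℝ) {i j : Fin N}
    (hij : S.G.Adj i j) : (c i j - α) ^ 2 ≤ 4 * S.κ i j * S.lyap P α c χ h := by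
  have hκ := hS.κ_pos i j hij
  have h1 : (c i j - α) ^ 2 / (4 * S.κ i j) ≤ S.lyap P α c χ h := by
    calc (c i j - α) ^ 2 / (4 * S.κ i j) = S.a i j * ((c i j - α) ^ 2 / (4 * S.κ i j)) := by
          rw [S.a_of_adj hij, one_mul]
      _ ≤ ∑ l, S.a i l * ((c i l - α) ^ 2 / (4 * S.κ i l)) :=
          Finset.single_le_sum (f := fun l => S.a i l * ((c i l - α) ^ 2 / (4 * S.κ i l)))
            (fun l _ => hS.gain_term_nonneg α c i l) (Finset.mem_univ j)
      _ ≤ ∑ k, ∑ l, S.a k l * ((c k l - α) ^ 2 / (4 * S.κ k l)) :=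
          Finset.single_le_sum
            (f := fun k => ∑ l, S.a k l * ((c k l - α) ^ 2 / (4 * S.κ k l)))
            (fun k _ => Finset.sum_nonneg fun l _ => hS.gain_term_nonneg α c k l)
            (Finset.mem_univ i)
      _ ≤ S.lyap P α c χ h := by
          have h2 : 0 ≤ ∑ i, quad P (dev χ i) :=
            Finset.sum_nonneg fun _ _ => quad_nonneg_of_posDef hP _
          have h3 : 0 ≤ ∑ i, quad P (h i - χ i) :=
            Finset.sum_nonneg fun _ _ => quad_nonneg_of_posDef hP _
          rw [lyap]; linarith
  rwa [div_le_iff₀ (by positivity), mul_comm] at h1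

theorem IsDesigned.abs_gain_le (hS : S.IsDesigned) {P : Matrix (Fin n) (Fin n) ℝ}
    (hP : P.PosDef) (α : ℝ) (c : Fin N → Fin N → ℝ) (χ h : Fin N → Fin n → ℝ) {i j : Fin N}
    (hij : S.G.Adj i j) : |c i j| ≤ |α| + (1 + 4 * S.κ i j * S.lyap P α c χ h) := by
  have h1 := hS.gain_sq_le_lyap hP α c χ h hij
  have h2 : |c i j - α| ≤ 1 + (c i j - α) ^ 2 := by
    rw [← sq_abs]; nlinarith [sq_nonneg (|c i j - α| - 1)]
  have h3 := abs_add_le α (c i j - α)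
  rw [add_sub_cancel] at h3
  linarith

theorem IsDesigned.exists_rate (hS : S.IsDesigned) :
    ∃ ρ : ℝ, 0 < ρ ∧ ∀ i j, S.G.Adj i j → ρ ≤ S.κ i j * S.ϱ i j := by
  -- Finitely many positive bounds hold for all small `x`; no minimum over a possibly empty edge set
  -- is needed.
  have h : ∀ᶠ x in 𝓝[>] (0 : ℝ), ∀ i j, S.G.Adj i j → x ≤ S.κ i j * S.ϱ i j := by
    refine eventually_all.2 fun i => eventually_all.2 fun j => ?_
    by_cases hij : S.G.Adj i j
    · filter_upwards [Ioc_mem_nhdsGT (mul_pos (hS.κ_pos i j hij) (hS.ϱ_pos i j hij))] with x hx _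
      exact hx.2
    · exact Eventually.of_forall fun x hx => absurd hx hij
  obtain ⟨ρ, h1, h2⟩ := (h.and self_mem_nhdsWithin).exists
  exact ⟨ρ, h2, h1⟩

end Loop

namespace Run

variable {N n p q : ℕ} {S : Loop N n p q} {r : Run N n}

theorem gain_abs_sum_nonneg (t : ℝ) : 0 ≤ ∑ i, ∑ j, S.a i j * |r.c t i j| :=
  Finset.sum_nonneg fun i _ => Finset.sum_nonneg fun j _ =>
    mul_nonneg (S.a_nonneg i j) (abs_nonneg _)

theorem sum_le_of_stackNorm_le {v : Fin N → Fin n → ℝ} {a : ℝ} (h : stackNorm v ≤ a) :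
    ∑ i, v i ⬝ᵥ v i ≤ a ^ 2 := by
  rw [← stackNorm_sq]
  exact pow_le_pow_left₀ (stackNorm_nonneg v) h 2

theorem observation_sq_le_of_stateSize {t a : ℝ} (h : r.stateSize S t ≤ a) :
    ∑ i, (r.χ t i - r.x t i) ⬝ᵥ (r.χ t i - r.x t i) ≤ a ^ 2 := by
  refine sum_le_of_stackNorm_le ?_
  unfold stateSize at h
  linarith [stackNorm_nonneg (r.consensusError t),
    stackNorm_nonneg (fun i => r.held S t i - r.χ t i), gain_abs_sum_nonneg (S := S) (r := r) t]

theorem gain_le_of_stateSize {t a : ℝ} (h : r.stateSize S t ≤ a) {i j : Fin N}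
    (hij : S.G.Adj i j) : |r.c t i j| ≤ a := by
  have h1 : |r.c t i j| ≤ ∑ i, ∑ j, S.a i j * |r.c t i j| := by
    have hnn : ∀ k l, 0 ≤ S.a k l * |r.c t k l| :=
      fun k l => mul_nonneg (S.a_nonneg k l) (abs_nonneg _)
    calc |r.c t i j| = S.a i j * |r.c t i j| := by rw [S.a_of_adj hij, one_mul]
      _ ≤ ∑ l, S.a i l * |r.c t i l| :=
          Finset.single_le_sum (f := fun l => S.a i l * |r.c t i l|) (fun l _ => hnn i l)
            (Finset.mem_univ j)
      _ ≤ _ := Finset.single_le_sum (f := fun k => ∑ l, S.a k l * |r.c t k l|)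
            (fun k _ => Finset.sum_nonneg fun l _ => hnn k l) (Finset.mem_univ i)
  unfold stateSize at h
  linarith [stackNorm_nonneg (r.consensusError t), stackNorm_nonneg (fun i => r.χ t i - r.x t i),
    stackNorm_nonneg (fun i => r.held S t i - r.χ t i)]

theorem dev_χ_sq_le (t : ℝ) : ∑ i, dev (r.χ t) i ⬝ᵥ dev (r.χ t) i ≤
    2 * ∑ i, r.consensusError t i ⬝ᵥ r.consensusError t i +
      2 * ∑ i, (r.χ t i - r.x t i) ⬝ᵥ (r.χ t i - r.x t i) := by
  have h1 := sum_dev_sq_le_self fun i => r.χ t i - r.x t i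
  have h2 : ∀ i, dev (r.χ t) i = r.consensusError t i + dev (fun i => r.χ t i - r.x t i) i :=
    fun i => by
      rw [dev_sub, show r.consensusError t i = dev (r.x t) i from rfl, add_sub_cancel]
  have h3 : ∑ i, dev (r.χ t) i ⬝ᵥ dev (r.χ t) i ≤ ∑ i, (2 * (r.consensusError t i ⬝ᵥ
      r.consensusError t i) + 2 * (dev (fun i => r.χ t i - r.x t i) i ⬝ᵥ
        dev (fun i => r.χ t i - r.x t i) i)) :=
    Finset.sum_le_sum fun i _ => by rw [h2 i]; exact dotProduct_add_self_le _ _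
  rw [Finset.sum_add_distrib, ← Finset.mul_sum, ← Finset.mul_sum] at h3
  linarith

theorem consensusError_sq_le (t : ℝ) :
    ∑ i, r.consensusError t i ⬝ᵥ r.consensusError t i ≤
    2 * ∑ i, dev (r.χ t) i ⬝ᵥ dev (r.χ t) i +
      2 * ∑ i, (r.χ t i - r.x t i) ⬝ᵥ (r.χ t i - r.x t i) := by
  have h1 := sum_dev_sq_le_self fun i => r.χ t i - r.x t i
  have h2 : ∀ i, r.consensusError t i = dev (r.χ t) i - dev (fun i => r.χ t i - r.x t i) i :=
    fun i => by
      rw [dev_sub, show r.consensusError t i = dev (r.x t) i from rfl, sub_sub_cancel]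
  have h3 : ∑ i, r.consensusError t i ⬝ᵥ r.consensusError t i ≤ ∑ i, (2 * (dev (r.χ t) i ⬝ᵥ
      dev (r.χ t) i) + 2 * (dev (fun i => r.χ t i - r.x t i) i ⬝ᵥ
        dev (fun i => r.χ t i - r.x t i) i)) :=
    Finset.sum_le_sum fun i _ => by rw [h2 i]; exact dotProduct_sub_self_le _ _
  rw [Finset.sum_add_distrib, ← Finset.mul_sum, ← Finset.mul_sum] at h3
  linarith

theorem lyap_le_of_stateSize (hS : S.IsDesigned) (P : Matrix (Fin n) (Fin n) ℝ)
    (α : ℝ) {t a : ℝ} (h : r.stateSize S t ≤ a) :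
    S.lyap P α (r.c t) (r.χ t) (r.held S t) ≤
      ∑ i, ∑ j, S.a i j * ((a + |α|) ^ 2 / (4 * S.κ i j)) + (1 + frobSq P) * (5 * a ^ 2) := by
  have hs := observation_sq_le_of_stateSize h
  have hz : ∑ i, r.consensusError t i ⬝ᵥ r.consensusError t i ≤ a ^ 2 := by
    refine sum_le_of_stackNorm_le ?_
    unfold stateSize at h
    linarith [stackNorm_nonneg (fun i => r.χ t i - r.x t i),
      stackNorm_nonneg (fun i => r.held S t i - r.χ t i), gain_abs_sum_nonneg (S := S) (r := r) t]
  have he : ∑ i, (r.held S t i - r.χ t i) ⬝ᵥ (r.held S t i - r.χ t i) ≤ a ^ 2 := by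
    refine sum_le_of_stackNorm_le (v := fun i => r.held S t i - r.χ t i) ?_
    unfold stateSize at h
    linarith [stackNorm_nonneg (r.consensusError t), stackNorm_nonneg (fun i => r.χ t i - r.x t i),
      gain_abs_sum_nonneg (S := S) (r := r) t]
  have hη := dev_χ_sq_le (r := r) t
  have h1 := Finset.sum_le_sum fun i (_ : i ∈ Finset.univ) => quad_le P (dev (r.χ t) i)
  have h2 := Finset.sum_le_sum fun i (_ : i ∈ Finset.univ) => quad_le P (r.held S t i - r.χ t i)
  rw [← Finset.mul_sum] at h1 h2
  have h3 : ∑ i, ∑ j, S.a i j * ((r.c t i j - α) ^ 2 / (4 * S.κ i j)) ≤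
      ∑ i, ∑ j, S.a i j * ((a + |α|) ^ 2 / (4 * S.κ i j)) := by
    refine Finset.sum_le_sum fun i _ => Finset.sum_le_sum fun j _ => ?_
    rcases S.a_eq_zero_or_one i j with ha | ha
    · simp [ha]
    · have hij := S.adj_of_a ha
      have hκ := hS.κ_pos i j hij
      have hc := gain_le_of_stateSize h hij
      rw [ha, one_mul, one_mul]
      refine div_le_div_of_nonneg_right ?_ (by positivity)
      rw [← sq_abs]
      exact pow_le_pow_left₀ (abs_nonneg _) ((abs_sub _ _).trans (by linarith)) 2
  have hP := frobSq_nonneg P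
  -- Here `5 = 2 + 2 + 1`: consensus and observation errors through `dev_χ_sq_le`, then the
  -- measurement errors.
  have h4 := mul_le_mul_of_nonneg_left (show ∑ i, dev (r.χ t) i ⬝ᵥ dev (r.χ t) i +
    ∑ i, (r.held S t i - r.χ t i) ⬝ᵥ (r.held S t i - r.χ t i) ≤ 5 * a ^ 2 by linarith)
    (show 0 ≤ 1 + frobSq P by linarith)
  rw [Loop.lyap]
  linarith

namespace IsExecution

theorem gain_lower (hr : r.IsExecution S) (hS : S.IsDesigned) {P : Matrix (Fin n) (Fin n) ℝ}
    (hP : S.IsRiccati P) {ρ : ℝ} (hρ : ∀ i j, S.G.Adj i j → ρ ≤ S.κ i j * S.ϱ i j) {a : ℝ}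
    {t₀ t : ℝ} (ht₀ : t₀ ∈ r.dom) (ht : t ∈ r.dom) (hle : t₀ ≤ t) (ha : 0 ≤ a)
    (hsize : r.stateSize S t₀ ≤ a) {i j : Fin N} (hij : S.G.Adj i j) :
    -(a * Real.exp (-ρ * (t - t₀))) ≤ r.c t i j := by
  have h1 := hr.neg_gain_le hS hP hij ht₀ ht hle
  have h2 := (neg_le_abs _).trans (gain_le_of_stateSize hsize hij)
  have h3 : Real.exp (-(S.κ i j * S.ϱ i j) * (t - t₀)) ≤ Real.exp (-ρ * (t - t₀)) := by
    refine Real.exp_le_exp.2 ?_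
    have := mul_le_mul_of_nonneg_right (hρ i j hij) (sub_nonneg.2 hle)
    linarith
  have h4 := mul_le_mul h2 h3 (Real.exp_pos _).le ha
  linarith

end IsExecution

end Run

/-! ### Transient and ultimate bounds. -/

/-- On bounded time intervals the Lyapunov function is bounded in terms of the initial size. -/
theorem exists_lyap_le_of_le_add {N n p q : ℕ} {S : Loop N n p q} (hS : S.IsDesigned)
    {P : Matrix (Fin n) (Fin n) ℝ} (hP : S.IsRiccati P) {α C₁ C₂ C₃ : ℝ}
    (hC₁ : 0 ≤ C₁) (hC₂ : 0 ≤ C₂) (hC₃ : 0 ≤ C₃)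
    (hrate : ∀ (t m : ℝ) (c : Fin N → Fin N → ℝ) (χ h s : Fin N → Fin n → ℝ), 0 ≤ t → 0 ≤ m →
        (∀ i j, S.G.Adj i j → c i j = c j i) → (∀ i j, S.G.Adj i j → -m ≤ c i j) →
        (∀ i, S.trigger t c i (χ i) h < 0) →
        S.lyapRate P α c χ h s ≤
          -(1 / 4 * ∑ i, ∑ j, S.a i j * (S.ϱ i j * (c i j - α) ^ 2))
          - 1 / 2 * (∑ i, dev χ i ⬝ᵥ dev χ i + ∑ i, (h i - χ i) ⬝ᵥ (h i - χ i))
          + m * (C₁ * (∑ i, dev χ i ⬝ᵥ dev χ i + ∑ i, (h i - χ i) ⬝ᵥ (h i - χ i)))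
          + C₂ + C₃ * ∑ i, s i ⬝ᵥ s i)
    {a : ℝ} (ha : 0 < a) (τ : ℝ) :
    ∃ b : ℝ, 0 ≤ b ∧ ∀ r : Run N n, r.IsExecution S → ∀ t₀ ∈ r.dom, r.stateSize S t₀ ≤ a →
      ∀ t ∈ r.dom, t₀ ≤ t → t ≤ t₀ + τ →
        S.lyap P α (r.c t) (r.χ t) (r.held S t) ≤ b ∧
        ∑ i, (r.χ t i - r.x t i) ⬝ᵥ (r.χ t i - r.x t i) ≤ b := by
  obtain ⟨CP, hCP, hCPq⟩ := exists_le_quad_of_posDef hP.posDef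
  obtain ⟨CH, hCH, hCHt⟩ := hS.hurwitz.exists_frobSq_exp_le
  obtain ⟨ρ, hρ, hρe⟩ := hS.exists_rate
  set U₀ := ∑ i, ∑ j, S.a i j * ((a + |α|) ^ 2 / (4 * S.κ i j)) + (1 + frobSq P) * (5 * a ^ 2)
    with hU₀
  -- Growth rate for the crude choice `m = a`; the `+ 1` keeps it nonzero.
  set k := a * (C₁ * CP) + 1 with hk
  have hk0 : 0 < k := by positivity
  set D := C₂ + C₃ * (CH * a ^ 2) with hD
  have hD0 : 0 ≤ D := by positivity
  have hU₀0 : 0 ≤ U₀ := by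
    refine add_nonneg (Finset.sum_nonneg fun i _ => Finset.sum_nonneg fun j _ => ?_) ?_
    · simpa using hS.gain_term_nonneg 0 (fun _ _ => a + |α|) i j
    · have := frobSq_nonneg P
      positivity
  refine ⟨(U₀ + D / k) * Real.exp (k * τ) + CH * a ^ 2, by positivity, ?_⟩
  intro r hr t₀ ht₀ hsize t ht hle hτ
  have hs : ∀ u ∈ r.dom, t₀ ≤ u →
      ∑ i, (r.χ u i - r.x u i) ⬝ᵥ (r.χ u i - r.x u i) ≤ CH * a ^ 2 := fun u hu htu =>
    (hr.sum_observation_error_le ht₀ hu htu).trans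
      (mul_le_mul (hCHt _ (sub_nonneg.2 htu)) (Run.observation_sq_le_of_stateSize hsize)
        (sum_dotProduct_self_nonneg _) hCH.le)
  have hexp : Real.exp (k * (t - t₀)) ≤ Real.exp (k * τ) :=
    Real.exp_le_exp.2 (mul_le_mul_of_nonneg_left (by linarith) hk0.le)
  have hsub := Run.Icc_subset_dom ht₀ ht
  have hg := le_exp_of_deriv_right_le (l := -k) (C := D) (neg_ne_zero.2 hk0.ne') hle
    ((hr.lyap_lowerSemicontinuousOn hP.posDef α).mono hsub)
    (fun u hu => hr.hasDerivWithinAt_lyap hS hP.posDef α (hsub ⟨hu.1, hu.2.le⟩)) ?_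
  · have hU := Run.lyap_le_of_stateSize hS P α hsize
    rw [neg_neg, div_neg, sub_neg_eq_add] at hg
    have hDk : 0 ≤ D / k := by positivity
    have h1 : (S.lyap P α (r.c t₀) (r.χ t₀) (r.held S t₀) + D / k) * Real.exp (k * (t - t₀)) ≤
        (U₀ + D / k) * Real.exp (k * τ) :=
      mul_le_mul (by linarith) hexp (Real.exp_pos _).le (by linarith)
    have h2 : 0 ≤ CH * a ^ 2 := by positivity
    have h3 : 0 ≤ (U₀ + D / k) * Real.exp (k * τ) := by positivity
    exact ⟨by linarith, (hs t ht hle).trans (by linarith)⟩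
  · intro u hu
    have hud := hsub ⟨hu.1, hu.2.le⟩
    have h1 := hrate u a (r.c u) (r.χ u) (r.held S u) (fun i => r.χ u i - r.x u i) hud.1 ha.le
      (fun i j hij => hr.gain_symm hS hij hud) (fun i j hij => ?_) (hr.trigger_neg u hud)
    · have h2 := hS.sq_le_lyap hCP hCPq α (r.c u) (r.χ u) (r.held S u)
      have h3 := mul_le_mul_of_nonneg_left (hs u hud hu.1) hC₃
      have h4 : 0 ≤ ∑ i, ∑ j, S.a i j * (S.ϱ i j * (r.c u i j - α) ^ 2) :=
        Finset.sum_nonneg fun i _ => Finset.sum_nonneg fun j _ => by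
          rcases S.a_eq_zero_or_one i j with h | h
          · simp [h]
          · have := hS.ϱ_pos i j (S.adj_of_a h)
            rw [h]; positivity
      have h5 := sum_dotProduct_self_nonneg fun i => dev (r.χ u) i
      have h6 := sum_dotProduct_self_nonneg fun i => r.held S u i - r.χ u i
      have h7 := mul_le_mul_of_nonneg_left (mul_le_mul_of_nonneg_left h2 hC₁) ha.le
      have h8 := hS.lyap_nonneg hP.posDef α (r.c u) (r.χ u) (r.held S u)
      have h9 : a * (C₁ * (CP * S.lyap P α (r.c u) (r.χ u) (r.held S u))) =
        (k - 1) * S.lyap P α (r.c u) (r.χ u) (r.held S u) := by rw [hk]; ring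
      linarith
    · have h1 := hr.gain_lower hS hP hρe ht₀ hud hu.1 ha.le hsize hij
      have h2 : Real.exp (-ρ * (u - t₀)) ≤ 1 := by
        refine Real.exp_le_one_iff.2 ?_
        have := mul_nonneg hρ.le (sub_nonneg.2 hu.1)
        linarith
      have h3 := mul_le_of_le_one_right ha.le h2
      linarith

/-- After a time depending only on the initial size, the Lyapunov function and the observation
errors are below a bound that does not depend on the initial size. -/
theorem exists_ultimate_lyap_le {N n p q : ℕ} {S : Loop N n p q} (hS : S.IsDesigned)
    (hG : S.G.Connected) (hN : Nontrivial (Fin N))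
    {P : Matrix (Fin n) (Fin n) ℝ} (hP : S.IsRiccati P) :
    ∃ α b : ℝ, 0 < b ∧ ∀ a : ℝ, 0 < a → ∃ τ : ℝ, 0 ≤ τ ∧
      ∀ r : Run N n, r.IsExecution S → ∀ t₀ ∈ r.dom, r.stateSize S t₀ ≤ a →
        ∀ t ∈ r.dom, t₀ + τ ≤ t →
          S.lyap P α (r.c t) (r.χ t) (r.held S t) ≤ b ∧
          ∑ i, (r.χ t i - r.x t i) ⬝ᵥ (r.χ t i - r.x t i) ≤ 1 := by
  obtain ⟨α, C₁, C₂, C₃, hC₁, hC₂, hC₃, hrate⟩ := hS.exists_lyapRate_le hG hN hP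
  obtain ⟨ρ, hρ, hρe⟩ := hS.exists_rate
  have hfP := frobSq_nonneg P
  -- The decay rate is limited by the leakage of the gains and by a quarter of `|·|²` against the
  -- `P`-energy. The other quarter of the dissipation is reserved for the `m` term, whence the
  -- threshold in `hm0`.
  set l := min ρ (1 / (4 * (1 + frobSq P))) with hl
  have hl0 : 0 < l := lt_min hρ (by positivity)
  have hlP : l * (1 + frobSq P) ≤ 1 / 4 := by
    calc l * (1 + frobSq P) ≤ 1 / (4 * (1 + frobSq P)) * (1 + frobSq P) :=
          mul_le_mul_of_nonneg_right (min_le_right _ _) (by positivity)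
      _ = 1 / 4 := by field_simp
  refine ⟨α, 1 + (C₂ + C₃) / l, by positivity, fun a ha => ?_⟩
  have hm0 : (0 : ℝ) < 1 / (4 * (C₁ + 1)) := by positivity
  have hexp0 : ∀ k : ℝ, 0 < k → ∀ d : ℝ,
      Tendsto (fun τ : ℝ => d * Real.exp (-k * τ)) atTop (𝓝 0) := fun k hk d => by
    have h1 : Tendsto (fun τ : ℝ => -k * τ) atTop atBot :=
      tendsto_id.const_mul_atTop_of_neg (neg_lt_zero.2 hk)
    simpa using (Real.tendsto_exp_atBot.comp h1).const_mul d
  have hev1 := (hexp0 ρ hρ a).eventually (gt_mem_nhds hm0)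
  have hev2 := (hS.hurwitz.tendsto_frobSq_exp.mul_const (a ^ 2)).eventually
    (gt_mem_nhds (show 0 * a ^ 2 < 1 by simp))
  -- After `τ₁` the gains are nearly nonnegative and the observation errors at most 1; after a
  -- further `τ₂` the transient bound `b₁` is forgotten.
  obtain ⟨τ₁, hτ₁⟩ := eventually_atTop.1 ((hev1.and hev2).and (eventually_ge_atTop 0))
  have hτ₁0 := (hτ₁ τ₁ le_rfl).2
  obtain ⟨b₁, hb₁0, hb₁⟩ := exists_lyap_le_of_le_add hS hP hC₁ hC₂ hC₃ hrate ha τ₁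
  obtain ⟨τ₂, hτ₂⟩ := eventually_atTop.1
    (((hexp0 l hl0 b₁).eventually (gt_mem_nhds one_pos)).and (eventually_ge_atTop 0))
  have hτ₂0 := (hτ₂ τ₂ le_rfl).2
  refine ⟨τ₁ + τ₂, by positivity, ?_⟩
  intro r hr t₀ ht₀ hsize t ht hτ
  set t₁ := t₀ + τ₁ with ht₁
  have ht₁d : t₁ ∈ r.dom := Run.mem_dom_of_le ht (add_nonneg ht₀.1 hτ₁0) (by linarith)
  have hle : t₁ ≤ t := by linarith
  have hs : ∀ u ∈ r.dom, t₁ ≤ u →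
      ∑ i, (r.χ u i - r.x u i) ⬝ᵥ (r.χ u i - r.x u i) ≤ 1 := fun u hu htu => by
    refine (hr.sum_observation_error_le ht₀ hu (by linarith)).trans ?_
    refine le_trans ?_ (hτ₁ (u - t₀) (by linarith)).1.2.le
    exact mul_le_mul_of_nonneg_left (Run.observation_sq_le_of_stateSize hsize) (frobSq_nonneg _)
  refine ⟨?_, hs t ht hle⟩
  have hsub := Run.Icc_subset_dom ht₁d ht
  have hg := le_exp_of_deriv_right_le (l := l) (C := C₂ + C₃) hl0.ne' hle
    ((hr.lyap_lowerSemicontinuousOn hP.posDef α).mono hsub)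
    (fun u hu => hr.hasDerivWithinAt_lyap hS hP.posDef α (hsub ⟨hu.1, hu.2.le⟩)) ?_
  · have h1 := (hb₁ r hr t₀ ht₀ hsize t₁ ht₁d (by linarith) le_rfl).1
    have h2 := (hτ₂ (t - t₁) (by linarith)).1
    have h3 : (S.lyap P α (r.c t₁) (r.χ t₁) (r.held S t₁) - (C₂ + C₃) / l) *
        Real.exp (-l * (t - t₁)) ≤ b₁ * Real.exp (-l * (t - t₁)) := by
      refine mul_le_mul_of_nonneg_right ?_ (Real.exp_pos _).le
      have : 0 ≤ (C₂ + C₃) / l := by positivity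
      linarith
    linarith
  · intro u hu
    have hud := hsub ⟨hu.1, hu.2.le⟩
    have h1 := hrate u (1 / (4 * (C₁ + 1))) (r.c u) (r.χ u) (r.held S u)
      (fun i => r.χ u i - r.x u i) hud.1 hm0.le
      (fun i j hij => hr.gain_symm hS hij hud) (fun i j hij => ?_) (hr.trigger_neg u hud)
    · have h3 := mul_le_mul_of_nonneg_left (hs u hud hu.1) hC₃
      have h4 : l * ∑ i, ∑ j, S.a i j * ((r.c u i j - α) ^ 2 / (4 * S.κ i j)) ≤
          1 / 4 * ∑ i, ∑ j, S.a i j * (S.ϱ i j * (r.c u i j - α) ^ 2) := by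
        simp only [Finset.mul_sum]
        refine Finset.sum_le_sum fun i _ => Finset.sum_le_sum fun j _ => ?_
        rcases S.a_eq_zero_or_one i j with h | h
        · simp [h]
        · have hij := S.adj_of_a h
          have hκ := hS.κ_pos i j hij
          have h5 : l ≤ S.κ i j * S.ϱ i j := (min_le_left _ _).trans (hρe i j hij)
          have h6 := mul_le_mul_of_nonneg_right h5
            (show 0 ≤ (r.c u i j - α) ^ 2 / (4 * S.κ i j) by positivity)
          rw [h, one_mul, one_mul]
          refine h6.trans (le_of_eq ?_)
          field_simp
      have h5 := Finset.sum_le_sum fun i (_ : i ∈ Finset.univ) => quad_le P (dev (r.χ u) i)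
      have h6 := Finset.sum_le_sum fun i (_ : i ∈ Finset.univ) =>
        quad_le P (r.held S u i - r.χ u i)
      rw [← Finset.mul_sum] at h5 h6
      have h7 := mul_le_mul_of_nonneg_left (add_le_add h5 h6) hl0.le
      have h8 : 0 ≤ ∑ i, dev (r.χ u) i ⬝ᵥ dev (r.χ u) i +
          ∑ i, (r.held S u i - r.χ u i) ⬝ᵥ (r.held S u i - r.χ u i) :=
        add_nonneg (sum_dotProduct_self_nonneg fun i => dev (r.χ u) i)
          (sum_dotProduct_self_nonneg fun i => r.held S u i - r.χ u i)
      have h9 := mul_le_mul_of_nonneg_right hlP h8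
      have h10 : 1 / (4 * (C₁ + 1)) * C₁ ≤ 1 / 4 := by
        rw [one_div_mul_eq_div, div_le_iff₀ (by positivity)]; linarith
      have h11 := mul_le_mul_of_nonneg_right h10 h8
      rw [mul_assoc] at h11
      rw [Loop.lyap]
      linarith
    · have h1 := hr.gain_lower hS hP hρe ht₀ hud (by linarith [hu.1]) ha.le hsize hij
      have h2 := (hτ₁ (u - t₀) (by linarith [hu.1])).1.1
      linarith

/-! ### Minimal inter-event times. -/

section Norms

variable {m n : ℕ}

theorem norm_le_sqrt_dotProduct_self (v : Fin n → ℝ) : ‖v‖ ≤ Real.sqrt (v ⬝ᵥ v) :=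
  (pi_norm_le_iff_of_nonneg (Real.sqrt_nonneg _)).2 fun i => abs_apply_le_sqrt v i

theorem dotProduct_self_le_norm_sq (v : Fin n → ℝ) : v ⬝ᵥ v ≤ n * ‖v‖ ^ 2 := by
  have h : ∀ i ∈ (Finset.univ : Finset (Fin n)), v i * v i ≤ ‖v‖ ^ 2 := fun i _ => by
    rw [← sq, ← sq_abs]
    exact pow_le_pow_left₀ (abs_nonneg _) (norm_le_pi_norm v i) 2
  simpa [dotProduct] using! Finset.sum_le_card_nsmul _ _ _ h

theorem exists_norm_mulVec_le (X : Matrix (Fin m) (Fin n) ℝ) :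
    ∃ C : ℝ, 0 ≤ C ∧ ∀ v, ‖X *ᵥ v‖ ≤ C * ‖v‖ :=
  ⟨‖LinearMap.toContinuousLinearMap X.mulVecLin‖, norm_nonneg _,
    fun v => (LinearMap.toContinuousLinearMap X.mulVecLin).le_opNorm v⟩

theorem norm_le_of_sum_le {N : ℕ} {v : Fin N → Fin n → ℝ} {b : ℝ} (h : ∑ i, v i ⬝ᵥ v i ≤ b)
    (i : Fin N) : ‖v i‖ ≤ Real.sqrt b :=
  (norm_le_sqrt_dotProduct_self _).trans (Real.sqrt_le_sqrt
    ((Finset.single_le_sum (f := fun i => v i ⬝ᵥ v i) (fun i _ => dotProduct_self_nonneg' (v i))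
      (Finset.mem_univ i)).trans h))

end Norms

/-- A bounded set of reals in which every element keeps a distance to its predecessors is finite. -/
theorem finite_of_separated {E : Set ℝ} {τ γ : ℝ} (hγ : 0 < γ) (h0 : ∀ t ∈ E, 0 ≤ t)
    (hτ : ∀ t ∈ E, t ≤ τ) (hsep : ∀ s ∈ E, ∀ t ∈ E, s < t → γ ≤ t - s) : E.Finite := by
  -- Each cell of length `γ` contains at most one point of `E`.
  have hmaps : MapsTo (fun t => ⌊t / γ⌋₊) E (Iic ⌊τ / γ⌋₊) := fun t ht =>
    Nat.floor_mono (div_le_div_of_nonneg_right (hτ t ht) hγ.le)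
  refine Set.Finite.of_injOn hmaps ?_ (Set.finite_Iic _)
  have key : ∀ s ∈ E, ∀ t ∈ E, ⌊s / γ⌋₊ = ⌊t / γ⌋₊ → ¬ s < t := by
    intro s hs t ht hst hlt
    have h1 := hsep s hs t ht hlt
    have h2 := Nat.lt_floor_add_one (t / γ)
    have h3 := Nat.floor_le (div_nonneg (h0 s hs) hγ.le)
    rw [← hst] at h2
    have h4 : t / γ - s / γ < 1 := by linarith
    rw [← sub_div, div_lt_one hγ] at h4
    linarith
  intro s hs t ht hst
  exact le_antisymm (not_lt.1 (key t ht s hs hst.symm)) (not_lt.1 (key s hs t ht hst))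

namespace Run.IsExecution

variable {N n p q : ℕ} {S : Loop N n p q} {r : Run N n}

/-- If the measurement error of an agent has bounded velocity `V`, then its size just before an
event is at most `V` times the time since its previous event. -/
theorem norm_heldPre_sub_le (hr : r.IsExecution S) {i : Fin N} {V : ℝ}
    (hV : ∀ t ∈ r.dom, ‖S.A *ᵥ r.held S t i - S.observerRate (r.c t) (r.χ t) (r.held S t)
      (fun i => r.χ t i - r.x t i) i‖ ≤ V) {t : ℝ} (ht : t ∈ r.dom) (h0 : 0 < t) :
    ‖r.heldPre S t i - r.χ t i‖ ≤ V * (t - sSup (r.E i ∩ Iio t)) := by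
  set σ := sSup (r.E i ∩ Iio t) with hσ
  obtain ⟨hσE, hσt⟩ := hr.sSup_mem_Iio i ht h0
  rw [← hσ] at hσE hσt
  simp only [mem_Iio] at hσt
  have hσd := hr.E_sub i hσE
  have hlast : ∀ s ∈ Ico σ t, r.held S s i = S.hold σ s (r.χ σ i) := by
    intro s hs
    have hle := hr.sSup_mem_Iic i (mem_dom_of_le ht (hσd.1.trans hs.1) hs.2.le)
    have : sSup (r.E i ∩ Iic s) = σ := by
      refine le_antisymm ?_ ?_
      · exact le_csSup ⟨t, fun e he => le_of_lt he.2⟩ ⟨hle.1, lt_of_le_of_lt hle.2 hs.2⟩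
      · exact le_csSup ⟨s, fun e he => he.2⟩ ⟨hσE, hs.1⟩
    rw [held, this]
  have hsub := Icc_subset_dom hσd ht
  have hc : ContinuousOn (fun s => S.hold σ s (r.χ σ i) - r.χ s i) (Icc σ t) :=
    ContinuousOn.sub (fun s _ =>
      -- Prolonging the model started at `σ` up to `t` itself ignores the reset at `t`, so the mean
      -- value inequality sees the error before the update.
      (hasDerivAt_exp_sub_smul_mulVec S.A σ s (r.χ σ i)).continuousAt.continuousWithinAt)
      ((hr.χ_continuousOn i).mono hsub)
  have h := norm_image_sub_le_of_norm_deriv_right_le_segment (C := V)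
    (f' := fun s => S.A *ᵥ r.held S s i - S.observerRate (r.c s) (r.χ s) (r.held S s)
      (fun i => r.χ s i - r.x s i) i) hc (fun s hs => ?_)
    (fun s hs => hV s (hsub ⟨hs.1, hs.2.le⟩)) t ⟨hσt.le, le_rfl⟩
  · have e1 : S.hold σ σ (r.χ σ i) - r.χ σ i = 0 := by
      rw [Loop.hold, sub_self, zero_smul, NormedSpace.exp_zero, Matrix.one_mulVec, sub_self]
    rw [e1, sub_zero] at h
    exact h
  · rw [hlast s hs]
    exact (hasDerivAt_exp_sub_smul_mulVec S.A σ s (r.χ σ i)).hasDerivWithinAt.sub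
      (hr.hasDerivWithinAt_χ (hsub ⟨hs.1, hs.2.le⟩) i)

/-- At an event, the measurement error before the reset is bounded from below. -/
theorem le_of_event (hr : r.IsExecution S) {P : Matrix (Fin n) (Fin n) ℝ}
    (hP : S.IsRiccati P) {i : Fin N} {t : ℝ} (ht : t ∈ r.E i) (h0 : 0 < t) :
    S.μ * Real.exp (-S.ν * t) ≤
      ∑ j, (1 + S.δ * r.c t i j) * S.a i j * quad S.Γ (r.heldPre S t i - r.χ t i) := by
  obtain ⟨w, hwi, -, hw⟩ := hr.event i t ht h0
  rw [Loop.trigger, hwi] at hw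
  -- Neighbours enter the test only through a nonpositive term, so the order of simultaneous updates
  -- is irrelevant.
  have h1 : 0 ≤ ∑ j, S.a i j * quad S.Γ (r.heldPre S t i - w j) :=
    Finset.sum_nonneg fun j _ => mul_nonneg (S.a_nonneg i j) (hP.quad_Γ_nonneg _)
  linarith

/-- An isolated agent never triggers after the initial time. -/
theorem finite_events_of_subsingleton (hr : r.IsExecution S) (hS : S.IsDesigned)
    (hN : Subsingleton (Fin N)) (i : Fin N) : (r.E i).Finite := by
  obtain ⟨P, hP⟩ := hS.exists_isRiccati
  refine (Set.finite_singleton (0 : ℝ)).subset fun t ht => ?_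
  by_contra hne
  have h0 : 0 < t := lt_of_le_of_ne (hr.E_sub i ht).1 (Ne.symm hne)
  have h := hr.le_of_event hP ht h0
  have ha : ∀ j, S.a i j = 0 := fun j =>
    (S.a_eq_zero_or_one i j).resolve_right fun h =>
      S.G.loopless.irrefl i (by simpa [Subsingleton.elim j i] using S.adj_of_a h)
  simp only [ha, mul_zero, zero_mul, Finset.sum_const_zero] at h
  exact absurd h (not_le.2 (mul_pos hS.μ_pos (Real.exp_pos _)))

theorem norm_error_rate_le {i : Fin N} {β g V₁ V₂ V₃ : ℝ} (hg : 0 ≤ g)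
    (h1 : ∀ v, ‖S.A *ᵥ v‖ ≤ V₁ * ‖v‖) (h2 : ∀ v, ‖(S.B * S.K) *ᵥ v‖ ≤ V₂ * ‖v‖)
    (h3 : ∀ v, ‖(S.F * S.C) *ᵥ v‖ ≤ V₃ * ‖v‖) (hV₁ : 0 ≤ V₁) (hV₂ : 0 ≤ V₂) (hV₃ : 0 ≤ V₃)
    {c : Fin N → Fin N → ℝ} {χ h s : Fin N → Fin n → ℝ} (hχ : ∀ j, ‖dev χ j‖ ≤ β)
    (he : ∀ j, ‖h j - χ j‖ ≤ β) (hs : ∀ j, ‖s j‖ ≤ β) (hc : ∀ j, S.G.Adj i j → |c i j| ≤ g) :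
    ‖S.A *ᵥ h i - S.observerRate c χ h s i‖ ≤ V₁ * β + V₂ * (N * (g * (4 * β))) + V₃ * β := by
  have hh : ∀ j, ‖h i - h j‖ ≤ 4 * β := fun j => by
    have e : h i - h j = (dev χ i - dev χ j) + ((h i - χ i) - (h j - χ j)) := by
      rw [dev_sub_dev]; abel
    rw [e]
    have := norm_add_le (dev χ i - dev χ j) ((h i - χ i) - (h j - χ j))
    have := norm_sub_le (dev χ i) (dev χ j)
    have := norm_sub_le (h i - χ i) (h j - χ j)
    linarith [hχ i, hχ j, he i, he j]
  have hf : ‖S.feedback c h i‖ ≤ N * (g * (4 * β)) := by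
    have : ∀ j ∈ (Finset.univ : Finset (Fin N)),
        ‖(c i j * S.a i j) • (h i - h j)‖ ≤ g * (4 * β) := fun j _ => by
      rw [norm_smul]
      refine mul_le_mul ?_ (hh j) (norm_nonneg _) hg
      rcases S.a_eq_zero_or_one i j with ha | ha
      · simpa [ha] using hg
      · rw [ha, mul_one]; exact hc j (S.adj_of_a ha)
    simpa using! norm_sum_le_of_le _ this
  rw [Loop.mulVec_sub_observerRate, Matrix.mulVec_mulVec, Matrix.mulVec_mulVec]
  refine (norm_sub_le _ _).trans (add_le_add ((norm_sub_le _ _).trans (add_le_add ?_ ?_)) ?_)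
  · exact (h1 _).trans (mul_le_mul_of_nonneg_left (he i) hV₁)
  · exact (h2 _).trans (mul_le_mul_of_nonneg_left hf hV₂)
  · exact (h3 _).trans (mul_le_mul_of_nonneg_left (hs i) hV₃)

/-- An execution on a bounded time interval has finitely many events of each agent. -/
theorem finite_events_of_bounded (hr : r.IsExecution S) (hS : S.IsDesigned) (hG : S.G.Connected)
    (hN : Nontrivial (Fin N)) {τ : ℝ} (hτ : ∀ t ∈ r.dom, t ≤ τ) (i : Fin N) :
    (r.E i).Finite := by
  obtain ⟨P, hP⟩ := hS.exists_isRiccati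
  obtain ⟨α, C₁, C₂, C₃, hC₁, hC₂, hC₃, hrate⟩ := hS.exists_lyapRate_le hG hN hP
  obtain ⟨CP, hCP, hCPq⟩ := exists_le_quad_of_posDef hP.posDef
  obtain ⟨b, hb0, hb⟩ := exists_lyap_le_of_le_add hS hP hC₁ hC₂ hC₃ hrate
    (show 0 < |r.stateSize S 0| + 1 by positivity) τ
  have hbd : ∀ t ∈ r.dom, S.lyap P α (r.c t) (r.χ t) (r.held S t) ≤ b ∧
      ∑ i, (r.χ t i - r.x t i) ⬝ᵥ (r.χ t i - r.x t i) ≤ b := fun t ht =>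
    hb r hr 0 hr.zero_mem_dom (by linarith [le_abs_self (r.stateSize S 0)]) t ht ht.1
      (by linarith [hτ t ht])
  obtain ⟨V₁, hV₁, h1⟩ := exists_norm_mulVec_le S.A
  obtain ⟨V₂, hV₂, h2⟩ := exists_norm_mulVec_le (S.B * S.K)
  obtain ⟨V₃, hV₃, h3⟩ := exists_norm_mulVec_le (S.F * S.C)
  obtain ⟨g, hg⟩ : ∃ g : ℝ, g = |α| + (1 + ∑ j, 4 * |S.κ i j| * b) :=
    ⟨_, rfl⟩
  have hsum0 : 0 ≤ ∑ j, 4 * |S.κ i j| * b := Finset.sum_nonneg fun j _ => by positivity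
  have hg0 : 0 ≤ g := by rw [hg]; positivity
  have hgain : ∀ t ∈ r.dom, ∀ j, S.G.Adj i j → |r.c t i j| ≤ g := fun t ht j hij => by
    refine (hS.abs_gain_le hP.posDef α (r.c t) (r.χ t) (r.held S t) hij).trans ?_
    have hκ := hS.κ_pos i j hij
    have e1 := mul_le_mul_of_nonneg_left (hbd t ht).1 (show 0 ≤ 4 * S.κ i j by positivity)
    have e2 := Finset.single_le_sum (f := fun j => 4 * |S.κ i j| * b)
      (fun j _ => by positivity) (Finset.mem_univ j)
    simp only [abs_of_pos hκ] at e2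
    linarith
  obtain ⟨β, hβ⟩ : ∃ β : ℝ, β = Real.sqrt (CP * b) + Real.sqrt b :=
    ⟨_, rfl⟩
  have hβ0 : 0 ≤ β := by rw [hβ]; positivity
  obtain ⟨V, hV⟩ : ∃ V : ℝ, V = V₁ * β + V₂ * (N * (g * (4 * β))) + V₃ * β :=
    ⟨_, rfl⟩
  have hVel : ∀ t ∈ r.dom, ‖S.A *ᵥ r.held S t i - S.observerRate (r.c t) (r.χ t) (r.held S t)
      (fun i => r.χ t i - r.x t i) i‖ ≤ V := fun t ht => by
    have hX := (hS.sq_le_lyap hCP hCPq α (r.c t) (r.χ t) (r.held S t)).trans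
      (mul_le_mul_of_nonneg_left (hbd t ht).1 hCP.le)
    have e1 := sum_dotProduct_self_nonneg fun i => dev (r.χ t) i
    have e2 := sum_dotProduct_self_nonneg fun i => r.held S t i - r.χ t i
    have e3 := Real.sqrt_nonneg b
    have e4 := Real.sqrt_nonneg (CP * b)
    rw [hV]
    refine norm_error_rate_le hg0 h1 h2 h3 hV₁ hV₂ hV₃ (fun j => ?_) (fun j => ?_)
      (fun j => ?_) (hgain t ht)
    · exact (norm_le_of_sum_le (v := fun i => dev (r.χ t) i) (b := CP * b) (by linarith) j).trans
        (by linarith)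
    · exact (norm_le_of_sum_le (v := fun i => r.held S t i - r.χ t i) (b := CP * b)
        (by linarith) j).trans (by linarith)
    · exact (norm_le_of_sum_le (v := fun i => r.χ t i - r.x t i) (hbd t ht).2 j).trans
        (by linarith)
  have hV0 : 0 ≤ V := by rw [hV]; positivity
  have hδ := hS.δ_pos
  have hμ := hS.μ_pos
  have hfΓ := frobSq_nonneg S.Γ
  -- With error at most `V d` after a time `d`, the triggering sum is at most `M d²`; the factor `n`
  -- converts the sup norm to the Euclidean one and `+ 1` keeps `M` positive. Since the sum must
  -- reach `θ`, the gap is at least `√(θ / M)`.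
  obtain ⟨M, hM⟩ : ∃ M : ℝ, M = N * ((1 + S.δ * g) * ((1 + frobSq S.Γ) * n)) * V ^ 2 + 1 :=
    ⟨_, rfl⟩
  have hM0 : 0 < M := by rw [hM]; positivity
  obtain ⟨θ, hθ⟩ : ∃ θ : ℝ, θ = S.μ * Real.exp (-S.ν * τ) :=
    ⟨_, rfl⟩
  have hθ0 : 0 < θ := hθ ▸ mul_pos hμ (Real.exp_pos _)
  have hgap : ∀ t ∈ r.E i, 0 < t → Real.sqrt (θ / M) ≤ t - sSup (r.E i ∩ Iio t) := by
    intro t ht h0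
    have htd := hr.E_sub i ht
    have hσ := (hr.sSup_mem_Iio i htd h0).2
    simp only [mem_Iio] at hσ
    have hn := hr.norm_heldPre_sub_le hVel htd h0
    set d := t - sSup (r.E i ∩ Iio t) with hd
    set v := r.heldPre S t i - r.χ t i with hv
    have hev := hr.le_of_event hP ht h0
    have hq : quad S.Γ v ≤ (1 + frobSq S.Γ) * n * (V * d) ^ 2 := by
      have e1 := quad_le S.Γ v
      have e2 := dotProduct_self_le_norm_sq v
      have e3 := pow_le_pow_left₀ (norm_nonneg v) hn 2
      calc quad S.Γ v ≤ (1 + frobSq S.Γ) * (v ⬝ᵥ v) := e1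
        _ ≤ (1 + frobSq S.Γ) * (n * (V * d) ^ 2) :=
            mul_le_mul_of_nonneg_left
              (e2.trans (mul_le_mul_of_nonneg_left e3 (Nat.cast_nonneg n))) (by positivity)
        _ = _ := by ring
    have hterm : ∀ j ∈ (Finset.univ : Finset (Fin N)),
        (1 + S.δ * r.c t i j) * S.a i j * quad S.Γ v ≤ (1 + S.δ * g) * quad S.Γ v := fun j _ => by
      refine mul_le_mul_of_nonneg_right ?_ (hP.quad_Γ_nonneg v)
      rcases S.a_eq_zero_or_one i j with ha | ha
      · rw [ha, mul_zero]; positivity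
      · rw [ha, mul_one]
        have := mul_le_mul_of_nonneg_left
          ((le_abs_self _).trans (hgain t htd j (S.adj_of_a ha))) hδ.le
        linarith
    have hsum := Finset.sum_le_card_nsmul _ _ _ hterm
    rw [Finset.card_univ, Fintype.card_fin, nsmul_eq_mul] at hsum
    have hexp : θ ≤ S.μ * Real.exp (-S.ν * t) := by
      rw [hθ]
      refine mul_le_mul_of_nonneg_left (Real.exp_le_exp.2 ?_) hμ.le
      have := mul_le_mul_of_nonneg_left (hτ t htd) hS.ν_pos.le
      linarith
    have hk : (0 : ℝ) ≤ N * (1 + S.δ * g) := by positivity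
    have h4 := mul_le_mul_of_nonneg_left hq hk
    have h5 : θ ≤ M * d ^ 2 := by
      have : M * d ^ 2 = N * (1 + S.δ * g) * ((1 + frobSq S.Γ) * n * (V * d) ^ 2) + d ^ 2 := by
        rw [hM]; ring
      rw [this]
      linarith [sq_nonneg d]
    refine Real.sqrt_le_iff.2 ⟨by linarith, ?_⟩
    rw [div_le_iff₀ hM0]
    linarith
  refine finite_of_separated (Real.sqrt_pos.2 (div_pos hθ0 hM0))
    (fun t ht => (hr.E_sub i ht).1) (fun t ht => hτ t (hr.E_sub i ht)) ?_
  intro s hs t ht hst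
  have h0 : 0 < t := lt_of_le_of_lt (hr.E_sub i hs).1 hst
  refine (hgap t ht h0).trans ?_
  have : s ≤ sSup (r.E i ∩ Iio t) := le_csSup ⟨t, fun e he => le_of_lt he.2⟩ ⟨hs, hst⟩
  linarith

end Run.IsExecution

/-! ### Conclusions. -/

theorem noZeno {N n p q : ℕ} {S : Loop N n p q} (hS : S.IsDesigned) (hG : S.G.Connected) :
    NoZeno S := by
  intro r hr i τ
  rcases subsingleton_or_nontrivial (Fin N) with hN | hN
  · exact (hr.finite_events_of_subsingleton hS hN i).subset inter_subset_left
  -- Before `T` finiteness is part of being an execution; the content is the case `T ≤ τ`, where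
  -- events might accumulate at `T`.
  by_cases hT : (τ : EReal) < r.T
  · rcases lt_or_ge τ 0 with h0 | h0
    · convert! Set.finite_empty (α := ℝ)
      refine eq_empty_of_forall_notMem fun t ht => ?_
      have h1 := (hr.E_sub i ht.1).1
      have h2 : t < τ := ht.2
      linarith
    · exact (hr.E_locFin i τ ⟨h0, hT⟩).subset (inter_subset_inter_right _ Iio_subset_Iic_self)
  · refine (hr.finite_events_of_bounded hS hG hN (τ := τ) (fun t ht => ?_) i).subset
      inter_subset_left
    exact (EReal.coe_lt_coe_iff.1 (ht.2.trans_le (not_lt.1 hT))).le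

theorem isUUB_consensusError {N n p q : ℕ} {S : Loop N n p q} (hS : S.IsDesigned)
    (hG : S.G.Connected) : IsUUB S (fun r t => stackNorm (r.consensusError t)) := by
  rcases subsingleton_or_nontrivial (Fin N) with hN | hN
  · refine ⟨1, one_pos, fun a _ => ⟨0, le_rfl, fun r _ t₀ _ _ t _ _ => ?_⟩⟩
    have h : stackNorm (r.consensusError t) = 0 := by
      rw [stackNorm_eq]
      have : ∀ i, r.consensusError t i = 0 := fun i => by
        have h1 := sum_dev (r.x t)
        rwa [Fintype.sum_subsingleton _ i] at h1
      simp [this]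
    simp [h]
  · obtain ⟨P, hP⟩ := hS.exists_isRiccati
    obtain ⟨α, b, hb, hlyap⟩ := exists_ultimate_lyap_le hS hG hN hP
    obtain ⟨CP, hCP, hCPq⟩ := exists_le_quad_of_posDef hP.posDef
    refine ⟨Real.sqrt (2 * (CP * b) + 2), by positivity, fun a ha => ?_⟩
    obtain ⟨τ, hτ0, hτ⟩ := hlyap a ha
    refine ⟨τ, hτ0, fun r hr t₀ ht₀ hsize t ht hle => ?_⟩
    obtain ⟨h1, h2⟩ := hτ r hr t₀ ht₀ hsize t ht hle
    have h3 := (hS.sq_le_lyap hCP hCPq α (r.c t) (r.χ t) (r.held S t)).trans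
      (mul_le_mul_of_nonneg_left h1 hCP.le)
    have h4 := Run.consensusError_sq_le (r := r) t
    have h5 := sum_dotProduct_self_nonneg fun i => r.held S t i - r.χ t i
    rw [abs_of_nonneg (stackNorm_nonneg _), stackNorm_eq]
    exact Real.sqrt_le_sqrt (by linarith)

theorem isUUB_gain {N n p q : ℕ} {S : Loop N n p q} (hS : S.IsDesigned)
    (hG : S.G.Connected) {i j : Fin N} (hij : S.G.Adj i j) : IsUUB S (fun r t => r.c t i j) := by
  have hN : Nontrivial (Fin N) := ⟨i, j, hij.ne⟩
  obtain ⟨P, hP⟩ := hS.exists_isRiccati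
  obtain ⟨α, b, hb, hlyap⟩ := exists_ultimate_lyap_le hS hG hN hP
  have hκ := hS.κ_pos i j hij
  refine ⟨|α| + (1 + 4 * S.κ i j * b), by positivity, fun a ha => ?_⟩
  obtain ⟨τ, hτ0, hτ⟩ := hlyap a ha
  refine ⟨τ, hτ0, fun r hr t₀ ht₀ hsize t ht hle => ?_⟩
  have h1 := (hτ r hr t₀ ht₀ hsize t ht hle).1
  have h2 := mul_le_mul_of_nonneg_left h1 (show 0 ≤ 4 * S.κ i j by positivity)
  have h3 := hS.abs_gain_le hP.posDef α (r.c t) (r.χ t) (r.held S t) hij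
  linarith

end EventConsensus

end

theorem theorem3 {N n p q : ℕ} (S : EventConsensus.Loop N n p q)
    (hstab : EventConsensus.IsStabilizable S.A S.B)
    (hdet : EventConsensus.IsDetectable S.A S.C)
    (hG : S.G.Connected)
    (hS : S.IsDesigned) :
    EventConsensus.IsUUB S (fun r t => EventConsensus.stackNorm (r.consensusError t)) ∧
    (∀ i j, S.G.Adj i j → EventConsensus.IsUUB S (fun r t => r.c t i j)) ∧
    EventConsensus.NoZeno S := by
  exact ⟨EventConsensus.isUUB_consensusError hS hG,
    fun _ _ hij => EventConsensus.isUUB_gain hS hG hij, EventConsensus.noZeno hS hG⟩
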